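/- Let $N=2^n$. In the bounded-error vector-in-subspace problem, Alice holds a pure $n$-qubit state, i.e. a unit vector $\psi\in\mathbb{C}^N$, and Bob holds an orthogonal projector $M$ on $\mathbb{C}^N$. They are promised that either $\langle\psi|M|\psi\rangle\ge 2/3$ or $\langle\psi|M|\psi\rangle\le 1/3$, and Bob must output $1$ in the first case and $0$ in the second. For a finite-dimensional complex Hilbert space $E$ and an integer $c\ge 0$, the closest-state protocol on $E$ with $c$ bits is the following one-way classical randomized protocol with shared randomness. The shared randomness consists of $K=2^c$ independent states $\phi_1,\dots,\phi_K$, each Haar-random on the unit sphere of $E$. On input a unit vector $\psi\in E$, Alice sends, using $c$ bits, the index $i$ for which $|\langle\phi_i|\psi\rangle|$ is maximal (the least such $i$ in case of ties). On input a projector $M$ on $E$, Bob outputs $0$ if $\langle\phi_i|M|\phi_i\rangle\le 1/2$, and $1$ otherwise. Theorem. For every $\varepsilon>0$ there is a constant $C>0$ such that for every $n\ge 0$ there is a number of bits $c\le C\sqrt{N}$, $N=2^n$, for which both of the following hold. 1. The bounded-error vector-in-subspace problem on $n$ qubits is solved, with failure probability at most $\varepsilon$ on every input satisfying the promise, by the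 $c$-bit one-way shared-randomness protocol in which Alice replaces $\psi$ by $(\psi,0)\in\mathbb{C}^N\oplus\mathbb{C}^N$, Bob replaces $M$ by $M\oplus(I-M)$ (which has trace $N$, half the dimension), and they run the closest-state protocol on $\mathbb{C}^N\oplus\mathbb{C}^N$ with $c$ bits. 2. On all inputs satisfying the promise for which moreover $\operatorname{tr}M=N/2$, the closest-state protocol on $\mathbb{C}^N$ itself with $c$ bits outputs the correct answer with failure probability at most $\varepsilon$. In particular, the bounded-error vector-in-subspace problem has a one-way classical randomized protocol with shared randomness that uses $O(\sqrt{N})$ bits. -/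

import Mathlib

open MeasureTheory Metric

noncomputable section

/-- A one-way classical randomized protocol with shared randomness, in which Alice holds an input in
`X`, Bob holds an input in `Y`, and the only communication is one string of `c` bits from Alice to
Bob. The shared randomness is a sample from the probability space `(Ω, μ)`, seen by both. -/
structure OneWayProtocol (X Y : Type) (c : ℕ) where
  Ω : Type
  mΩ : MeasurableSpace Ω
  μ : Measure Ω
  isProb : IsProbabilityMeasure μ
  /-- the message that Alice sends -/
  alice : X → Ω → (Fin c → Bool)
  /-- the bit that Bob outputs -/
  bob : Y → Ω → (Fin c → Bool) → Bool
  measurable_alice : ∀ x, Measurable (alice x)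
  measurable_bob : ∀ y m, Measurable fun ω => bob y ω m

namespace OneWayProtocol

/-- The probability that Bob outputs the bit `b` on inputs `x`, `y`. -/
def prOutput {X Y : Type} {c : ℕ} (P : OneWayProtocol X Y c) (x : X) (y : Y) (b : Bool) : ℝ :=
  letI := P.mΩ
  P.μ.real {ω | P.bob y ω (P.alice x ω) = b}

/-- `P` computes the partial function with 1-inputs `one` and 0-inputs `zero`, with failure
probability at most `ε` on every input that satisfies the promise. -/
def Computes {X Y : Type} {c : ℕ} (P : OneWayProtocol X Y c) (one zero : X → Y → Prop)
    (ε : ℝ) : Prop :=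
  ∀ x y, (one x y → 1 - ε ≤ P.prOutput x y true) ∧ (zero x y → 1 - ε ≤ P.prOutput x y false)

/-- Alice and Bob first map their inputs locally, then run the protocol `P`. -/
def comap {X Y X' Y' : Type} {c : ℕ} (P : OneWayProtocol X' Y' c) (f : X → X') (g : Y → Y') :
    OneWayProtocol X Y c where
  Ω := P.Ω
  mΩ := P.mΩ
  μ := P.μ
  isProb := P.isProb
  alice x := P.alice (f x)
  bob y := P.bob (g y)
  measurable_alice x := P.measurable_alice (f x)
  measurable_bob y m := P.measurable_bob (g y) m

end OneWayProtocol

/-- The space `ℂ^N`, `N = 2 ^ n`, of `n` qubits, with the computational basis indexed by bit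
strings. -/
abbrev Qubits (n : ℕ) : Type := EuclideanSpace ℂ (Fin n → Bool)

/-- Pure states: unit vectors. -/
abbrev PureState (E : Type) [NormedAddCommGroup E] : Type := sphere (0 : E) 1

/-- The orthogonal projectors `M`, each standing for the two-outcome measurement `{M, I - M}`. -/
abbrev Projector (E : Type) [NormedAddCommGroup E] [InnerProductSpace ℂ E] [CompleteSpace E] :
    Type := {M : E →L[ℂ] E // IsStarProjection M}

/-- The (real) number `⟨ψ|M|ψ⟩`. -/
def expect {E : Type} [NormedAddCommGroup E] [InnerProductSpace ℂ E] (M : E →L[ℂ] E) (ψ : E) : ℝ :=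
  (inner ℂ ψ (M ψ)).re

section HaarProtocol

variable (E : Type) [NormedAddCommGroup E] [InnerProductSpace ℂ E] [FiniteDimensional ℂ E]
  [MeasurableSpace E] [BorelSpace E]

/-- The uniform (Haar) probability measure on the unit sphere of `E`: the normalized surface measure
induced by Lebesgue measure. -/
def haarState : Measure (PureState E) :=
  ((Measure.addHaar : Measure E).toSphere Set.univ)⁻¹ • (Measure.addHaar : Measure E).toSphere

theorem haarState_isProb [Nontrivial E] : IsProbabilityMeasure (haarState E) := by
  constructor
  have h0 : (Measure.addHaar : Measure E).toSphere Set.univ ≠ 0 := by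
    rw [Ne, Measure.measure_univ_eq_zero]
    exact Measure.toSphere_ne_zero (Measure.addHaar : Measure E)
  simpa [haarState] using ENNReal.inv_mul_cancel h0 (measure_ne_top _ _)

end HaarProtocol

section Closest

variable {E : Type} [NormedAddCommGroup E] [InnerProductSpace ℂ E]

/-- The least index `i` for which the overlap `|⟨φ i|ψ⟩|` is maximal. -/
def closest {K : ℕ} [NeZero K] (ψ : PureState E) (φ : Fin K → PureState E) : Fin K :=
  (Finset.univ.filter fun i => ∀ j, ‖inner ℂ (φ j : E) (ψ : E)‖ ≤ ‖inner ℂ (φ i : E) (ψ : E)‖).min'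
    (by
      obtain ⟨i, -, hi⟩ := Finset.exists_max_image (Finset.univ : Finset (Fin K))
        (fun i => ‖inner ℂ (φ i : E) (ψ : E)‖) Finset.univ_nonempty
      exact ⟨i, by simpa using hi⟩)

theorem closest_eq_iff {K : ℕ} [NeZero K] (ψ : PureState E) (φ : Fin K → PureState E) (i : Fin K) :
    closest ψ φ = i ↔
      (∀ j, ‖inner ℂ (φ j : E) (ψ : E)‖ ≤ ‖inner ℂ (φ i : E) (ψ : E)‖) ∧
      ∀ k, (∀ j, ‖inner ℂ (φ j : E) (ψ : E)‖ ≤ ‖inner ℂ (φ k : E) (ψ : E)‖) → i ≤ k := by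
  unfold closest
  rw [Finset.min'_eq_iff]
  simp

theorem measurable_closest [FiniteDimensional ℂ E] [MeasurableSpace E] [BorelSpace E]
    {K : ℕ} [NeZero K] (ψ : PureState E) :
    Measurable fun φ : Fin K → PureState E => closest ψ φ := by
  have : ProperSpace E := FiniteDimensional.proper ℂ E
  have hm : ∀ i : Fin K, Measurable fun φ : Fin K → PureState E =>
      ‖inner ℂ (φ i : E) (ψ : E)‖ := fun i => by fun_prop
  refine measurable_to_countable' fun i => ?_
  have : (fun φ : Fin K → PureState E => closest ψ φ) ⁻¹' {i} =
      {φ | (∀ j, ‖inner ℂ (φ j : E) (ψ : E)‖ ≤ ‖inner ℂ (φ i : E) (ψ : E)‖) ∧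
        ∀ k, (∀ j, ‖inner ℂ (φ j : E) (ψ : E)‖ ≤ ‖inner ℂ (φ k : E) (ψ : E)‖) → i ≤ k} := by
    ext φ
    exact closest_eq_iff ψ φ i
  rw [this]
  have hs : ∀ k : Fin K, MeasurableSet {φ : Fin K → PureState E |
      ∀ j, ‖inner ℂ (φ j : E) (ψ : E)‖ ≤ ‖inner ℂ (φ k : E) (ψ : E)‖} := fun k => by
    rw [Set.ofPred_forall]
    exact MeasurableSet.iInter fun j => measurableSet_le (hm j) (hm k)
  refine (hs i).inter ?_
  change MeasurableSet {φ : Fin K → PureState E |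
    ∀ k, (∀ j, ‖inner ℂ (φ j : E) (ψ : E)‖ ≤ ‖inner ℂ (φ k : E) (ψ : E)‖) → i ≤ k}
  rw [Set.ofPred_forall]
  refine MeasurableSet.iInter fun k => ?_
  by_cases h : i ≤ k
  · simp [h]
  · simp only [h, imp_false]
    exact (hs k).compl

end Closest

/-- Binary encoding of the indices below `2 ^ c` by strings of `c` bits. -/
def toBits (c : ℕ) : Fin (2 ^ c) ≃ (Fin c → Bool) :=
  finFunctionFinEquiv.symm.trans ((Equiv.refl _).arrowCongr finTwoEquiv)

/-- The closest-state protocol on `E`: the shared randomness consists of `2 ^ c` independent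
Haar-random states; Alice sends, in `c` bits, the index `i` of the one that has the largest overlap
with her state; Bob outputs 0 if `⟨φ i|M|φ i⟩ ≤ 1 / 2`, and 1 otherwise. -/
def closestStateProtocol (E : Type) [NormedAddCommGroup E] [InnerProductSpace ℂ E]
    [FiniteDimensional ℂ E] [MeasurableSpace E] [BorelSpace E] [Nontrivial E] [CompleteSpace E]
    (c : ℕ) :
    OneWayProtocol (PureState E) (Projector E) c where
  Ω := Fin (2 ^ c) → PureState E
  mΩ := inferInstance
  μ := Measure.pi fun _ => haarState E
  isProb := by
    have := haarState_isProb E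
    infer_instance
  alice ψ φ := toBits c (closest ψ φ)
  bob M φ m := !decide (expect M.1 (φ ((toBits c).symm m)) ≤ 1 / 2)
  measurable_alice ψ := (measurable_of_countable (toBits c)).comp (measurable_closest ψ)
  measurable_bob M m := by
    have : ProperSpace E := FiniteDimensional.proper ℂ E
    refine (measurable_of_countable Bool.not).comp (measurable_to_bool ?_)
    have h : Measurable fun φ : Fin (2 ^ c) → PureState E =>
        expect M.1 (φ ((toBits c).symm m) : E) := by
      unfold expect
      fun_prop
    convert measurableSet_le h (measurable_const (a := (1 / 2 : ℝ))) using 1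
    ext φ
    simp

section Doubling

variable {E : Type} [NormedAddCommGroup E] [InnerProductSpace ℂ E] [CompleteSpace E]

/-- The state `(ψ, 0)` of the Hilbert space `E ⊕ E`. -/
def doubleState (ψ : PureState E) : PureState (WithLp 2 (E × E)) :=
  ⟨WithLp.toLp 2 ((ψ : E), 0), by simp⟩

/-- The operator `M ⊕ (I - M)` on the Hilbert space `E ⊕ E`. -/
def doubleOp (M : E →L[ℂ] E) : WithLp 2 (E × E) →L[ℂ] WithLp 2 (E × E) :=
  (WithLp.prodContinuousLinearEquiv 2 ℂ E E).symm.toContinuousLinearMap ∘L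
    (M.prodMap (1 - M)) ∘L (WithLp.prodContinuousLinearEquiv 2 ℂ E E).toContinuousLinearMap

theorem isStarProjection_doubleOp {M : E →L[ℂ] E} (hM : IsStarProjection M) :
    IsStarProjection (doubleOp M) := by
  have hN : IsStarProjection (1 - M) := hM.one_sub
  constructor
  · have h1 : ∀ x, M (M x) = M x := fun x => congrArg (fun T => T x) hM.isIdempotentElem.eq
    unfold IsIdempotentElem
    ext x : 1
    apply WithLp.ofLp_injective 2
    ext <;> simp [doubleOp, h1]
  · rw [ContinuousLinearMap.isSelfAdjoint_iff_isSymmetric]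
    have h1 := hM.isSelfAdjoint.isSymmetric
    have h2 := hN.isSelfAdjoint.isSymmetric
    intro x y
    have e1 := h1 x.fst y.fst
    have e2 := h2 x.snd y.snd
    simp only [ContinuousLinearMap.coe_coe] at e1 e2
    simpa [doubleOp, WithLp.prod_inner_apply] using congrArg₂ (· + ·) e1 e2

/-- The projector `M ⊕ (I - M)` on `E ⊕ E`. Its rank is half the dimension of `E ⊕ E`, and its
expectation in `(ψ, 0)` is that of `M` in `ψ`. -/
def doubleProjector (M : Projector E) : Projector (WithLp 2 (E × E)) :=
  ⟨doubleOp M.1, isStarProjection_doubleOp M.2⟩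

end Doubling

end

/-! Put `Z = 2M - 1`, a symmetric contraction, traceless when `M` has half rank. A 1-input has
`⟨ψ|Z|ψ⟩ ≥ 1/3`, and failure means `⟨φ|Z|φ⟩ ≤ 0` for the selected state `φ`; 0-inputs follow by
passing to `-Z`. In dimension `D`, write `φ = αψ + w` with `w ⊥ ψ`. Then `⟨φ|Z|φ⟩` is `|α|²⟨ψ|Z|ψ⟩`,
plus a cross term of order `|α|/√D`, plus `⟨w|Z|w⟩`, of order `1/√D` because the compression of `Z`
to `ψᗮ` has trace at most 1 in modulus. So `|α|² ≥ A/√D` with `A` large makes the signal dominate.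
One Haar state has such an overlap with probability at least `exp(-O(A√D))`
(`haarState_overlap_ge`), so `2^c` states with `c = O(√D)` suffice.

Selection does not spoil the randomness of `w`: the choice depends only on overlaps with `ψ`. Given
the other states, the selected one is Haar measure restricted to a set defined by its overlap
(`pi_closest_mem_le`), and this law is invariant under the stabilizer of `ψ`. Invariance alone
bounds the second moments needed (`integral_diagonalForm_sq_le`), and Markov's inequality gives
`haarState_real_inter_nonpos_le`. Bounded dimensions are handled with overlap 99/100, where the sign
is right deterministically. Doubling removes the trace condition at the cost of a factor `√2`. -/

open scoped Pointwise

/-! ### Cones over subsets of the sphere, and coordinates along `ψ`. -/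

section UnitSphere

variable {E : Type} [NormedAddCommGroup E] [InnerProductSpace ℂ E]

theorem mem_Ioo_smul_iff {s : Set (PureState E)} {y : E} :
    y ∈ Set.Ioo (0 : ℝ) 1 • ((↑) '' s : Set E) ↔
      ∃ x ∈ s, ∃ r : ℝ, 0 < r ∧ r < 1 ∧ r • (x : E) = y := by
  constructor
  · rintro ⟨r, hr, _, ⟨x, hx, rfl⟩, rfl⟩
    exact ⟨x, hx, r, hr.1, hr.2, rfl⟩
  · rintro ⟨x, hx, r, h0, h1, rfl⟩
    exact ⟨r, ⟨h0, h1⟩, _, ⟨x, hx, rfl⟩, rfl⟩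

/-- The action of a linear isometry on the unit sphere. -/
def sphereMap (U : E ≃ₗᵢ[ℂ] E) (x : PureState E) : PureState E :=
  ⟨U x, by simp⟩

theorem measurable_sphereMap [MeasurableSpace E] [BorelSpace E] (U : E ≃ₗᵢ[ℂ] E) : Measurable (sphereMap U) :=
  (U.continuous.measurable.comp measurable_subtype_coe).subtype_mk

/-- The decomposition `E ≃ ℂ × ψᗮ` along a unit vector `ψ`. -/
noncomputable def prodOrthogonalEquiv (ψ : E) (hψ : ‖ψ‖ = 1) : (ℂ × (ℂ ∙ ψ)ᗮ) ≃ₗ[ℂ] E :=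
  LinearEquiv.ofBijective
    ((LinearMap.toSpanSingleton ℂ E ψ).coprod (ℂ ∙ ψ)ᗮ.subtype) (by
      have hi : inner ℂ ψ ψ = 1 := by simp [inner_self_eq_norm_sq_to_K, hψ]
      constructor
      · rw [← LinearMap.ker_eq_bot, LinearMap.ker_eq_bot']
        rintro ⟨z, w⟩ h
        have h' : z • ψ + (w : E) = 0 := by simpa using h
        have hw : inner ℂ ψ (w : E) = 0 :=
          Submodule.mem_orthogonal_singleton_iff_inner_right.1 w.2
        have hz : z = 0 := by
          have := congrArg (inner ℂ ψ) h'
          rw [inner_add_right, inner_smul_right, hw, hi] at this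
          simpa using this
        subst hz
        simpa using h'
      · intro x
        refine ⟨(inner ℂ ψ x, ⟨x - inner ℂ ψ x • ψ, ?_⟩), by simp⟩
        rw [Submodule.mem_orthogonal_singleton_iff_inner_right]
        rw [inner_sub_right, inner_smul_right, hi, mul_one, sub_self])

theorem prodOrthogonalEquiv_apply (ψ : E) (hψ : ‖ψ‖ = 1) (p : ℂ × (ℂ ∙ ψ)ᗮ) :
    prodOrthogonalEquiv ψ hψ p = p.1 • ψ + (p.2 : E) := rfl

theorem inner_prodOrthogonalEquiv (ψ : E) (hψ : ‖ψ‖ = 1) (p : ℂ × (ℂ ∙ ψ)ᗮ) :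
    inner ℂ ψ (prodOrthogonalEquiv ψ hψ p) = p.1 := by
  have hi : inner ℂ ψ ψ = 1 := by simp [inner_self_eq_norm_sq_to_K, hψ]
  have hw : inner ℂ ψ (p.2 : E) = 0 := Submodule.mem_orthogonal_singleton_iff_inner_right.1 p.2.2
  rw [prodOrthogonalEquiv_apply, inner_add_right, inner_smul_right, hi, hw, mul_one, add_zero]

theorem norm_sq_prodOrthogonalEquiv (ψ : E) (hψ : ‖ψ‖ = 1) (p : ℂ × (ℂ ∙ ψ)ᗮ) :
    ‖prodOrthogonalEquiv ψ hψ p‖ ^ 2 = ‖p.1‖ ^ 2 + ‖p.2‖ ^ 2 := by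
  have hw : inner ℂ ψ (p.2 : E) = 0 := Submodule.mem_orthogonal_singleton_iff_inner_right.1 p.2.2
  rw [prodOrthogonalEquiv_apply, sq, norm_add_sq_eq_norm_sq_add_norm_sq_of_inner_eq_zero (𝕜 := ℂ)]
  · rw [norm_smul, hψ, mul_one, ← sq, ← sq]; rfl
  · simp [inner_smul_left, hw]

end UnitSphere

/-! ### Unitary invariance of Haar measure and a lower bound for spherical caps. -/

section HaarMeasure

variable {E : Type} [NormedAddCommGroup E] [InnerProductSpace ℂ E] [FiniteDimensional ℂ E]
  [MeasurableSpace E] [BorelSpace E]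

/-- Additive Haar measures differ by a scalar, which cancels in the normalization along with the
dimension factor. This frees the choice of `μ`: a pushforward under `U` for invariance, a product
measure for caps. -/
theorem haarState_mul_ball [Nontrivial E] (μ : Measure E) [μ.IsAddHaarMeasure]
    {s : Set (PureState E)} (hs : MeasurableSet s) :
    haarState E s * μ (ball 0 1) = μ (Set.Ioo (0 : ℝ) 1 • ((↑) '' s)) := by
  have hK : (Measure.addHaar : Measure E) =
      (Measure.addHaar : Measure E).addHaarScalarFactor μ • μ :=
    Measure.isAddLeftInvariant_eq_smul _ _
  have hd : (Module.finrank ℝ E : ENNReal) ≠ 0 := by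
    simpa using (Module.finrank_pos (R := ℝ) (M := E)).ne'
  have hc : ((Measure.addHaar : Measure E).addHaarScalarFactor μ : ENNReal) ≠ 0 := by
    intro h
    have h0 : (Measure.addHaar : Measure E) (ball 0 1) ≠ 0 := (measure_ball_pos _ _ one_pos).ne'
    apply h0
    rw [hK, Measure.smul_apply, ENNReal.smul_def, h, zero_smul]
  have hb : μ (ball 0 1) ≠ 0 := (measure_ball_pos _ _ one_pos).ne'
  have hb' : μ (ball 0 1) ≠ ⊤ := measure_ball_lt_top.ne
  unfold haarState
  rw [Measure.smul_apply, Measure.toSphere_apply_univ, Measure.toSphere_apply' _ hs]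
  rw [hK]
  generalize (Measure.addHaar : Measure E).addHaarScalarFactor μ = c at hc
  simp only [Measure.smul_apply, ENNReal.smul_def, smul_eq_mul]
  rw [← mul_assoc, ← mul_assoc, ENNReal.mul_inv (.inl hd) (.inl (by simp)),
    ENNReal.mul_inv (.inl hc) (.inl (by simp))]
  have h1 : ((Module.finrank ℝ E : ENNReal))⁻¹ * (Module.finrank ℝ E : ENNReal) = 1 :=
    ENNReal.inv_mul_cancel hd (by simp)
  have h2 : (c : ENNReal)⁻¹ * c = 1 := ENNReal.inv_mul_cancel hc (by simp)
  have h3 : (μ (ball 0 1))⁻¹ * μ (ball 0 1) = 1 := ENNReal.inv_mul_cancel hb hb'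
  set d : ENNReal := (Module.finrank ℝ E : ENNReal)
  set V := μ (Set.Ioo (0 : ℝ) 1 • ((↑) '' s))
  calc _ = (d⁻¹ * d) * ((c : ENNReal)⁻¹ * c) * ((μ (ball 0 1))⁻¹ * μ (ball 0 1)) * V := by ring
    _ = V := by rw [h1, h2, h3]; simp

theorem haarState_preimage_sphereMap [Nontrivial E] (U : E ≃ₗᵢ[ℂ] E) {s : Set (PureState E)}
    (hs : MeasurableSet s) : haarState E (sphereMap U ⁻¹' s) = haarState E s := by
  have hU := measurable_sphereMap U hs
  let L : E ≃L[ℝ] E := U.toContinuousLinearEquiv.restrictScalars ℝ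
  have hL : ∀ x, L x = U x := fun _ => rfl
  have hm : Measurable L := L.continuous.measurable
  have : (Measure.map L (Measure.addHaar : Measure E)).IsAddHaarMeasure :=
    L.isAddHaarMeasure_map _
  have h1 := haarState_mul_ball (Measure.map L (Measure.addHaar : Measure E)) hs
  have h2 := haarState_mul_ball (Measure.addHaar : Measure E) hU
  have e : MeasurableEmbedding L := L.toHomeomorph.measurableEmbedding
  rw [e.map_apply, e.map_apply] at h1
  have hb : L ⁻¹' ball 0 1 = ball 0 1 := by
    ext x; simp [hL]
  have hc : L ⁻¹' (Set.Ioo (0 : ℝ) 1 • ((↑) '' s : Set E)) =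
      Set.Ioo (0 : ℝ) 1 • ((↑) '' (sphereMap U ⁻¹' s) : Set E) := by
    ext y
    rw [Set.mem_preimage, mem_Ioo_smul_iff, mem_Ioo_smul_iff]
    constructor
    · rintro ⟨x, hx, r, h0, h1, h⟩
      refine ⟨sphereMap U.symm x, ?_, r, h0, h1, ?_⟩
      · simpa [sphereMap] using hx
      · apply L.injective
        rw [← h, map_smul]
        simp [sphereMap, hL]
    · rintro ⟨x, hx, r, h0, h1, rfl⟩
      exact ⟨sphereMap U x, hx, r, h0, h1, by rw [map_smul]; rfl⟩
  rw [hb, hc, ← h2] at h1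
  exact ((ENNReal.mul_left_inj (measure_ball_pos _ _ one_pos).ne' measure_ball_lt_top.ne).1 h1).symm

theorem measurableSet_overlap_ge (ψ : E) (t : ℝ) :
    MeasurableSet {x : PureState E | t ≤ ‖inner ℂ (x : E) ψ‖ ^ 2} := by
  have : ProperSpace E := FiniteDimensional.proper ℂ E
  exact measurableSet_le measurable_const (by fun_prop)

/-- In coordinates `ℂ × ψᗮ`, the cone over the cap contains an annulus of area `πh` times a ball of
radius `√(1-t-h)`, while the unit ball lies in a disc of area `π` times the unit ball of `ψᗮ`. As
`ψᗮ` has real dimension `2m`, the ratio of volumes is `h (1-t-h)^m`. -/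
theorem haarState_overlap_ge [Nontrivial E] (ψ : E) (hψ : ‖ψ‖ = 1) {m : ℕ}
    (hm : Module.finrank ℂ E = m + 1) {t h : ℝ} (ht : 0 < t) (hh : 0 ≤ h) (hth : t + h < 1) :
    ENNReal.ofReal (h * (1 - t - h) ^ m) ≤
      haarState E {x : PureState E | t ≤ ‖inner ℂ (x : E) ψ‖ ^ 2} := by
  let F := (ℂ ∙ ψ)ᗮ
  let L : (ℂ × F) ≃L[ℝ] E :=
    LinearEquiv.toContinuousLinearEquiv ((prodOrthogonalEquiv ψ hψ).restrictScalars ℝ)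
  have hL : ∀ p, L p = prodOrthogonalEquiv ψ hψ p := fun _ => rfl
  let ρ : Measure F := Measure.addHaar
  let μ : Measure E := Measure.map L ((volume : Measure ℂ).prod ρ)
  have : μ.IsAddHaarMeasure := L.isAddHaarMeasure_map _
  have e : MeasurableEmbedding L := L.toHomeomorph.measurableEmbedding
  have hs := measurableSet_overlap_ge ψ t
  have h1 := haarState_mul_ball μ hs
  set s := {x : PureState E | t ≤ ‖inner ℂ (x : E) ψ‖ ^ 2} with hsdef
  have hF : Module.finrank ℂ F = m := by
    have hne : ψ ≠ 0 := by rintro rfl; simp at hψ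
    have := Submodule.finrank_add_finrank_orthogonal (ℂ ∙ ψ)
    rw [finrank_span_singleton hne, hm] at this
    change Module.finrank ℂ (ℂ ∙ ψ)ᗮ = m
    omega
  have hFR : Module.finrank ℝ F = 2 * m := by
    rw [← hF, ← Module.finrank_mul_finrank ℝ ℂ F, Complex.finrank_real_complex]
  have hpi : (NNReal.pi : ENNReal) = ENNReal.ofReal Real.pi := by
    rw [← NNReal.coe_real_pi, ENNReal.ofReal_coe_nnreal]
  have hball : μ (ball 0 1) ≤ ENNReal.ofReal Real.pi * ρ (ball 0 1) := by
    have hsub : L ⁻¹' ball 0 1 ⊆ ball (0 : ℂ) 1 ×ˢ ball (0 : F) 1 := by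
      rintro p hp
      have hp' : ‖L p‖ < 1 := by simpa using hp
      have h2 := norm_sq_prodOrthogonalEquiv ψ hψ p
      rw [← hL] at h2
      have h3 : ‖p.1‖ ^ 2 + ‖p.2‖ ^ 2 < 1 := by
        rw [← h2]; nlinarith [norm_nonneg (L p)]
      refine Set.mem_prod.2 ⟨?_, ?_⟩ <;> rw [mem_ball_zero_iff] <;>
        nlinarith [norm_nonneg p.1, norm_nonneg p.2, sq_nonneg ‖p.1‖, sq_nonneg ‖p.2‖]
    calc μ (ball 0 1) = ((volume : Measure ℂ).prod ρ) (L ⁻¹' ball 0 1) := e.map_apply _ _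
      _ ≤ ((volume : Measure ℂ).prod ρ) (ball (0 : ℂ) 1 ×ˢ ball (0 : F) 1) := measure_mono hsub
      _ = _ := by
        rw [Measure.prod_prod, Complex.volume_ball]
        simp [hpi]
  set r := Real.sqrt (1 - t - h) with hr
  have hr2 : r ^ 2 = 1 - t - h := Real.sq_sqrt (by linarith)
  have hr0 : 0 ≤ r := Real.sqrt_nonneg _
  have hcone : ENNReal.ofReal (Real.pi * h) * (ENNReal.ofReal ((1 - t - h) ^ m) * ρ (ball 0 1)) ≤
      μ (Set.Ioo (0 : ℝ) 1 • ((↑) '' s)) := by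
    have hsub : (ball (0 : ℂ) (Real.sqrt (t + h)) \ ball (0 : ℂ) (Real.sqrt t)) ×ˢ
        ball (0 : F) r ⊆ L ⁻¹' (Set.Ioo (0 : ℝ) 1 • ((↑) '' s)) := by
      rintro p ⟨⟨ha, hb⟩, hc⟩
      rw [mem_ball_zero_iff] at ha hb hc
      rw [Real.lt_sqrt (norm_nonneg _)] at ha
      rw [not_lt, Real.sqrt_le_left (norm_nonneg _)] at hb
      have hc2 : ‖p.2‖ ^ 2 < 1 - t - h := by
        rw [← hr2]; exact pow_lt_pow_left₀ hc (norm_nonneg _) two_ne_zero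
      have h2 := norm_sq_prodOrthogonalEquiv ψ hψ p
      have h4 := inner_prodOrthogonalEquiv ψ hψ p
      rw [← hL] at h2 h4
      have hlt : ‖L p‖ ^ 2 < 1 := by rw [h2]; linarith
      have hpos : 0 < ‖L p‖ := by
        have : 0 < ‖L p‖ ^ 2 := by rw [h2]; nlinarith [sq_nonneg ‖p.2‖]
        exact lt_of_le_of_ne (norm_nonneg _) fun h0 => by rw [← h0] at this; simp at this
      have hlt1 : ‖L p‖ < 1 := by nlinarith
      rw [Set.mem_preimage, mem_Ioo_smul_iff]
      refine ⟨⟨‖L p‖⁻¹ • L p, ?_⟩, ?_, ‖L p‖, hpos, hlt1, ?_⟩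
      · simp [norm_smul, hpos.ne']
      -- Projecting radially from inside the ball to the sphere can only increase the overlap.
      · change t ≤ ‖inner ℂ (‖L p‖⁻¹ • L p) ψ‖ ^ 2
        rw [norm_inner_symm, ← Complex.coe_smul, inner_smul_right, h4, norm_mul, mul_pow]
        have : 1 ≤ ‖((‖L p‖⁻¹ : ℝ) : ℂ)‖ ^ 2 := by
          rw [Complex.norm_real, norm_inv, norm_norm]
          exact one_le_pow₀ ((one_le_inv₀ hpos).2 hlt1.le)
        nlinarith [sq_nonneg ‖p.1‖]
      · simp [smul_smul, hpos.ne']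
    have hann : volume (ball (0 : ℂ) (Real.sqrt (t + h)) \ ball (0 : ℂ) (Real.sqrt t)) =
        ENNReal.ofReal (Real.pi * h) := by
      rw [measure_sdiff (ball_subset_ball (Real.sqrt_le_sqrt (by linarith)))
        measurableSet_ball.nullMeasurableSet measure_ball_lt_top.ne]
      rw [Complex.volume_ball, Complex.volume_ball, ← ENNReal.ofReal_pow (Real.sqrt_nonneg _),
        ← ENNReal.ofReal_pow (Real.sqrt_nonneg _), Real.sq_sqrt (by linarith),
        Real.sq_sqrt ht.le]
      rw [hpi, ← ENNReal.ofReal_mul (by linarith), ← ENNReal.ofReal_mul ht.le,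
        ← ENNReal.ofReal_sub _ (by positivity)]
      congr 1; ring
    have hrb : ρ (ball 0 r) = ENNReal.ofReal ((1 - t - h) ^ m) * ρ (ball 0 1) := by
      rcases Nat.eq_zero_or_pos m with rfl | hmp
      · have : Subsingleton F := Module.finrank_zero_iff.1 hF
        have hb : ∀ a : ℝ, 0 < a → ball (0 : F) a = Set.univ := fun a ha =>
          Set.eq_univ_of_forall fun x => by rw [Subsingleton.elim x 0]; exact mem_ball_self ha
        rw [hb r (Real.sqrt_pos.2 (by linarith)), hb 1 one_pos]
        simp
      · have : Nontrivial F := Module.nontrivial_of_finrank_pos (R := ℂ) (by omega)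
        rw [Measure.addHaar_ball ρ 0 hr0, hFR, pow_mul, hr2]
    calc _ = ((volume : Measure ℂ).prod ρ)
          ((ball (0 : ℂ) (Real.sqrt (t + h)) \ ball (0 : ℂ) (Real.sqrt t)) ×ˢ ball (0 : F) r) := by
          rw [Measure.prod_prod, hann, hrb]
      _ ≤ ((volume : Measure ℂ).prod ρ) (L ⁻¹' (Set.Ioo (0 : ℝ) 1 • ((↑) '' s))) :=
          measure_mono hsub
      _ = _ := (e.map_apply _ _).symm
  have hρ : ρ (ball 0 1) ≠ 0 := (measure_ball_pos _ _ one_pos).ne'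
  have hρ' : ρ (ball 0 1) ≠ ⊤ := measure_ball_lt_top.ne
  have hπ : ENNReal.ofReal Real.pi ≠ 0 := by simpa using Real.pi_pos
  have key : ENNReal.ofReal (h * (1 - t - h) ^ m) * (ENNReal.ofReal Real.pi * ρ (ball 0 1)) ≤
      haarState E s * (ENNReal.ofReal Real.pi * ρ (ball 0 1)) := by
    calc _ = ENNReal.ofReal (Real.pi * h) * (ENNReal.ofReal ((1 - t - h) ^ m) * ρ (ball 0 1)) := by
          rw [ENNReal.ofReal_mul hh, ENNReal.ofReal_mul Real.pi_pos.le]; ring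
      _ ≤ _ := hcone
      _ = haarState E s * μ (ball 0 1) := h1.symm
      _ ≤ _ := by gcongr
  exact (ENNReal.mul_le_mul_iff_left (mul_ne_zero hπ hρ) (ENNReal.mul_ne_top (by simp) hρ')).1 key

end HaarMeasure

/-! ### The law of the selected state. -/

section ClosestSelection

variable {E : Type} [NormedAddCommGroup E] [InnerProductSpace ℂ E]

theorem closest_congr {K : ℕ} [NeZero K] (ψ : PureState E) {φ φ' : Fin K → PureState E}
    (h : ∀ j, ‖inner ℂ (φ j : E) (ψ : E)‖ = ‖inner ℂ (φ' j : E) (ψ : E)‖) :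
    closest ψ φ = closest ψ φ' := by
  rw [closest_eq_iff]
  have := (closest_eq_iff ψ φ' (closest ψ φ')).1 rfl
  simpa [h] using this

theorem norm_inner_le_closest {K : ℕ} [NeZero K] (ψ : PureState E) (φ : Fin K → PureState E)
    (j : Fin K) :
    ‖inner ℂ (φ j : E) (ψ : E)‖ ≤ ‖inner ℂ (φ (closest ψ φ) : E) (ψ : E)‖ :=
  ((closest_eq_iff ψ φ (closest ψ φ)).1 rfl).1 j

/-- A set of states that is determined by the overlap with `ψ`. -/
def OverlapSaturated (ψ : E) (S : Set (PureState E)) : Prop :=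
  ∀ x y : PureState E, ‖inner ℂ (x : E) ψ‖ = ‖inner ℂ (y : E) ψ‖ → x ∈ S → y ∈ S

variable [FiniteDimensional ℂ E] [MeasurableSpace E] [BorelSpace E]

theorem measurableSet_closest_eq_overlap_ge {K : ℕ} [NeZero K] (ψ : PureState E) (i : Fin K)
    (t : ℝ) : MeasurableSet {φ : Fin K → PureState E |
      closest ψ φ = i ∧ t ≤ ‖inner ℂ (φ i : E) (ψ : E)‖ ^ 2} := by
  have h1 : MeasurableSet {φ : Fin K → PureState E | closest ψ φ = i} :=
    measurable_closest ψ (measurableSet_singleton i)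
  have h2 : MeasurableSet {φ : Fin K → PureState E | t ≤ ‖inner ℂ (φ i : E) (ψ : E)‖ ^ 2} :=
    measurable_pi_apply (X := fun _ : Fin K => PureState E) i
      (measurableSet_overlap_ge (ψ : E) t)
  exact h1.inter h2

/-- Fubini over the other `k` states: with these fixed, the event that `i` is selected with overlap
at least `t` is a condition on the overlap of `φ i` alone, so `h` applies to each section. -/
theorem pi_closest_eq_inter_le {k : ℕ} (μ : Measure (PureState E)) [IsProbabilityMeasure μ]
    (ψ : PureState E) {B : Set (PureState E)} (hB : MeasurableSet B) {t : ℝ} {δ : ENNReal}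
    (h : ∀ S : Set (PureState E), MeasurableSet S → OverlapSaturated (ψ : E) S →
      (∀ x ∈ S, t ≤ ‖inner ℂ (x : E) (ψ : E)‖ ^ 2) → μ (S ∩ B) ≤ δ * μ S) (i : Fin (k + 1)) :
    Measure.pi (fun _ : Fin (k + 1) => μ)
        {φ | (closest ψ φ = i ∧ t ≤ ‖inner ℂ (φ i : E) (ψ : E)‖ ^ 2) ∧ φ i ∈ B} ≤
      δ * Measure.pi (fun _ : Fin (k + 1) => μ)
        {φ | closest ψ φ = i ∧ t ≤ ‖inner ℂ (φ i : E) (ψ : E)‖ ^ 2} := by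
  have hmp := (measurePreserving_piFinSuccAbove (fun _ : Fin (k + 1) => μ) i).symm
  set e := (MeasurableEquiv.piFinSuccAbove (fun _ : Fin (k + 1) => PureState E) i).symm
  have hA : MeasurableSet {φ : Fin (k + 1) → PureState E |
      closest ψ φ = i ∧ t ≤ ‖inner ℂ (φ i : E) (ψ : E)‖ ^ 2} :=
    measurableSet_closest_eq_overlap_ge ψ i t
  set A := {φ : Fin (k + 1) → PureState E |
      closest ψ φ = i ∧ t ≤ ‖inner ℂ (φ i : E) (ψ : E)‖ ^ 2} with hAdef
  have hAB : MeasurableSet {φ | φ ∈ A ∧ φ i ∈ B} := hA.inter (measurable_pi_apply i hB)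
  change Measure.pi (fun _ : Fin (k + 1) => μ) {φ | φ ∈ A ∧ φ i ∈ B} ≤ _
  rw [← hmp.measure_preimage hAB.nullMeasurableSet, ← hmp.measure_preimage hA.nullMeasurableSet,
    Measure.prod_apply_symm (e.measurable hAB), Measure.prod_apply_symm (e.measurable hA),
    ← lintegral_const_mul _ (measurable_measure_prodMk_right (e.measurable hA))]
  refine lintegral_mono fun y => ?_
  have hi : ∀ x : PureState E, e (x, y) i = x := fun x =>
    Fin.insertNth_apply_same (α := fun _ => PureState E) i x y
  have hj : ∀ (x : PureState E) (j : Fin k), e (x, y) (i.succAbove j) = y j := fun x j =>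
    Fin.insertNth_apply_succAbove (α := fun _ => PureState E) i x y j
  have hS := h ((fun x => (x, y)) ⁻¹' (e ⁻¹' A)) (measurable_prodMk_right (e.measurable hA)) ?_ ?_
  · convert hS using 2
    ext x
    simp [hi]
  · intro x x' hxx hx
    have hc : closest ψ (e (x, y)) = closest ψ (e (x', y)) := by
      refine closest_congr ψ fun j => ?_
      rcases Fin.eq_self_or_eq_succAbove i j with rfl | ⟨j, rfl⟩
      · rw [hi, hi]; exact hxx
      · rw [hj, hj]
    change closest ψ (e (x, y)) = i ∧ t ≤ ‖inner ℂ (e (x, y) i : E) (ψ : E)‖ ^ 2 at hx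
    change closest ψ (e (x', y)) = i ∧ t ≤ ‖inner ℂ (e (x', y) i : E) (ψ : E)‖ ^ 2
    rw [hi] at hx ⊢
    rwa [← hc, ← hxx]
  · intro x hx
    have := hx.2
    rwa [hi] at this

/-- Either every state has overlap below `t`, or the selected one reaches `t`. The latter events are
disjoint over the selected index, so summing them costs a single `δ` rather than `K * δ`. -/
theorem pi_closest_mem_le {K : ℕ} [NeZero K] (μ : Measure (PureState E)) [IsProbabilityMeasure μ]
    (ψ : PureState E) {B : Set (PureState E)} (hB : MeasurableSet B) {t : ℝ} {δ : ENNReal}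
    (h : ∀ S : Set (PureState E), MeasurableSet S → OverlapSaturated (ψ : E) S →
      (∀ x ∈ S, t ≤ ‖inner ℂ (x : E) (ψ : E)‖ ^ 2) → μ (S ∩ B) ≤ δ * μ S) :
    Measure.pi (fun _ : Fin K => μ) {φ | φ (closest ψ φ) ∈ B} ≤
      (1 - μ {x : PureState E | t ≤ ‖inner ℂ (x : E) (ψ : E)‖ ^ 2}) ^ K + δ := by
  obtain ⟨k, rfl⟩ := Nat.exists_eq_succ_of_ne_zero (NeZero.ne K)
  set T := {x : PureState E | t ≤ ‖inner ℂ (x : E) (ψ : E)‖ ^ 2} with hT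
  have hTm : MeasurableSet T := measurableSet_overlap_ge (ψ : E) t
  let A : Fin (k + 1) → Set (Fin (k + 1) → PureState E) := fun i =>
    {φ | closest ψ φ = i ∧ t ≤ ‖inner ℂ (φ i : E) (ψ : E)‖ ^ 2}
  have hA : ∀ i, MeasurableSet (A i) := fun i =>
    measurableSet_closest_eq_overlap_ge ψ i t
  have hsub : {φ : Fin (k + 1) → PureState E | φ (closest ψ φ) ∈ B} ⊆
      Set.univ.pi (fun _ => Tᶜ) ∪ ⋃ i, {φ | φ ∈ A i ∧ φ i ∈ B} := by
    intro φ hφ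
    by_cases hc : t ≤ ‖inner ℂ (φ (closest ψ φ) : E) (ψ : E)‖ ^ 2
    · exact Or.inr (Set.mem_iUnion.2 ⟨closest ψ φ, ⟨rfl, hc⟩, hφ⟩)
    · refine Or.inl fun j _ hj => hc (le_trans hj ?_)
      exact pow_le_pow_left₀ (norm_nonneg _) (norm_inner_le_closest ψ φ j) 2
  refine (measure_mono hsub).trans ((measure_union_le _ _).trans (add_le_add ?_ ?_))
  · rw [Measure.pi_pi, Finset.prod_const, prob_compl_eq_one_sub hTm]
    simp
  · calc _ ≤ ∑ i, Measure.pi (fun _ : Fin (k + 1) => μ) {φ | φ ∈ A i ∧ φ i ∈ B} :=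
          measure_iUnion_fintype_le _ _
      _ ≤ ∑ i, δ * Measure.pi (fun _ : Fin (k + 1) => μ) (A i) :=
          Finset.sum_le_sum fun i _ => pi_closest_eq_inter_le μ ψ hB h i
      _ = δ * Measure.pi (fun _ : Fin (k + 1) => μ) (⋃ i, A i) := by
          rw [← Finset.mul_sum, measure_iUnion _ hA, tsum_fintype]
          intro i j hij
          exact Set.disjoint_left.2 fun φ h1 h2 => hij (h1.1.symm.trans h2.1)
      _ ≤ δ := by
          calc _ ≤ δ * 1 := by gcongr; exact prob_le_one
            _ = δ := mul_one δ

end ClosestSelection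

/-! ### Transitivity on orthonormal frames, and a basis adapted to `ψ` and `Z`. -/

section OrthonormalFrames

variable {E : Type} [NormedAddCommGroup E] [InnerProductSpace ℂ E] [FiniteDimensional ℂ E]

theorem exists_linearIsometryEquiv_map_orthonormal {k : ℕ} {v w : Fin k → E}
    (hv : Orthonormal ℂ v) (hw : Orthonormal ℂ w) : ∃ U : E ≃ₗᵢ[ℂ] E, ∀ i, U (v i) = w i := by
  have hk : k ≤ Module.finrank ℂ E := by
    simpa using hv.linearIndependent.fintype_card_le_finrank
  obtain ⟨r, hr⟩ := Nat.exists_eq_add_of_le hk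
  have hcard : Module.finrank ℂ E = Fintype.card (Fin k ⊕ Fin r) := by simpa using hr
  have ext : ∀ u : Fin k → E, Orthonormal ℂ u →
      ∃ b : OrthonormalBasis (Fin k ⊕ Fin r) ℂ E, ∀ i, b (Sum.inl i) = u i := by
    intro u hu
    obtain ⟨b, hb⟩ := Orthonormal.exists_orthonormalBasis_extension_of_card_eq hcard
      (v := Sum.elim u 0) (s := Set.range Sum.inl) (by
        have hc : (Set.range (Sum.inl : Fin k → Fin k ⊕ Fin r)).domRestrict (Sum.elim u 0) =
            u ∘ (Equiv.ofInjective _ Sum.inl_injective).symm := by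
          funext ⟨x, i, hi⟩
          subst hi
          simp only [Set.domRestrict_apply, Sum.elim_inl, Function.comp]
          congr 1
          rw [Equiv.eq_symm_apply]
          rfl
        rw [hc]
        exact hu.comp _ (Equiv.injective _))
    exact ⟨b, fun i => by simpa using hb (Sum.inl i) ⟨i, rfl⟩⟩
  obtain ⟨b, hb⟩ := ext v hv
  obtain ⟨b', hb'⟩ := ext w hw
  refine ⟨b.equiv b' (Equiv.refl _), fun i => ?_⟩
  rw [← hb, OrthonormalBasis.equiv_apply_basis]
  simp [hb']

/-- The basis consists of `ψ` and an eigenbasis of the compression of `Z` to `ψᗮ`; matrix entries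
involving `ψ` are unconstrained. -/
theorem exists_orthonormalBasis_diagonal_compression {Z : E →ₗ[ℂ] E} (hZ : Z.IsSymmetric) {ψ : E}
    (hψ : ‖ψ‖ = 1) {m : ℕ} (hm : Module.finrank ℂ E = m + 1) :
    ∃ (b : OrthonormalBasis (Option (Fin m)) ℂ E) (l : Fin m → ℝ), b none = ψ ∧
      ∀ j k, inner ℂ (b (some j)) (Z (b (some k))) = if j = k then (l j : ℂ) else 0 := by
  let F := (ℂ ∙ ψ)ᗮ
  let T : F →ₗ[ℂ] F := F.orthogonalProjectionOnto.toLinearMap ∘ₗ Z ∘ₗ F.subtype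
  have hT : ∀ u v : F, inner ℂ u (T v) = inner ℂ (u : E) (Z (v : E)) := fun u v =>
    Submodule.inner_orthogonalProjectionOnto_eq_of_mem_left u (Z (v : E))
  have hTs : T.IsSymmetric := fun u v => by
    rw [← inner_conj_symm, hT, hT, inner_conj_symm, hZ]
  have hF : Module.finrank ℂ F = m := by
    have hne : ψ ≠ 0 := by rintro rfl; simp at hψ
    have := Submodule.finrank_add_finrank_orthogonal (ℂ ∙ ψ)
    rw [finrank_span_singleton hne, hm] at this
    change Module.finrank ℂ (ℂ ∙ ψ)ᗮ = m
    omega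
  let e := hTs.eigenvectorBasis hF
  have he : Orthonormal ℂ fun j => (e j : E) :=
    e.orthonormal.comp_linearIsometry F.subtypeₗᵢ
  have hψe : ∀ j, inner ℂ ψ (e j : E) = 0 := fun j =>
    Submodule.mem_orthogonal_singleton_iff_inner_right.1 (e j).2
  have hv : Orthonormal ℂ (fun o : Option (Fin m) => o.elim ψ fun j => (e j : E)) := by
    rw [orthonormal_iff_ite]
    rintro (_ | i) (_ | j)
    · simp [inner_self_eq_norm_sq_to_K, hψ]
    · simpa using hψe j
    · simpa using inner_eq_zero_symm.1 (hψe i)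
    · simpa using orthonormal_iff_ite.1 he i j
  have hcard : Module.finrank ℂ E = Fintype.card (Option (Fin m)) := by simpa using hm
  obtain ⟨b, hb⟩ := Orthonormal.exists_orthonormalBasis_extension_of_card_eq hcard
    (v := fun o : Option (Fin m) => o.elim ψ fun j => (e j : E)) (s := Set.univ)
    (hv.comp _ Subtype.val_injective)
  have hb' : ∀ j, b (some j) = (e j : E) := fun j => hb (some j) trivial
  refine ⟨b, hTs.eigenvalues hF, hb none trivial, fun j k => ?_⟩
  rw [hb', hb', ← hT, hTs.apply_eigenvectorBasis, inner_smul_right]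
  change _ * inner ℂ (e j) (e k) = _
  rw [orthonormal_iff_ite.1 e.orthonormal j k]
  split_ifs with h
  · subst h; simp
  · simp

end OrthonormalFrames

/-! ### Signal, cross term and diagonal noise in `⟨x|Z|x⟩`. -/

section QuadraticForm

variable {E : Type} [NormedAddCommGroup E] [InnerProductSpace ℂ E]

/-- The diagonal quadratic form `∑ j, l j * |⟨b j|x⟩|²` on the span of the basis vectors other
than `b none`. -/
noncomputable def diagonalForm {m : ℕ} (b : OrthonormalBasis (Option (Fin m)) ℂ E) (l : Fin m → ℝ) (x : E) : ℝ :=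
  ∑ j, l j * ‖inner ℂ (b (some j)) x‖ ^ 2

variable {m : ℕ} {b : OrthonormalBasis (Option (Fin m)) ℂ E} {l : Fin m → ℝ} {Z : E →ₗ[ℂ] E}
  {ψ : E}

/-- Expand at `x = αψ + w`. The cross term is `2 Re(ᾱ⟨ψ|Z w⟩)`, and `⟨ψ|Z w⟩` is the inner product
of `x` with the component of `Zψ` orthogonal to `ψ`. -/
theorem re_inner_apply_lower_bound (hZ : Z.IsSymmetric) (hb : b none = ψ)
    (hl : ∀ j k, inner ℂ (b (some j)) (Z (b (some k))) = if j = k then (l j : ℂ) else 0) (x : E) :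
    ‖inner ℂ ψ x‖ ^ 2 * (inner ℂ ψ (Z ψ)).re -
        2 * ‖inner ℂ ψ x‖ * ‖inner ℂ (Z ψ - inner ℂ ψ (Z ψ) • ψ) x‖ + diagonalForm b l x ≤
      (inner ℂ x (Z x)).re := by
  set α := inner ℂ ψ x with hα
  set w := ∑ j, inner ℂ (b (some j)) x • b (some j) with hw
  have hx : x = α • ψ + w := by
    conv_lhs => rw [← b.sum_repr' x, Fintype.sum_option, hb]
  have hψw : inner ℂ ψ w = 0 := by
    rw [hw, inner_sum]
    refine Finset.sum_eq_zero fun j _ => ?_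
    rw [inner_smul_right, ← hb, orthonormal_iff_ite.1 b.orthonormal]
    simp
  have hψψ : inner ℂ ψ ψ = 1 := by
    rw [← hb, orthonormal_iff_ite.1 b.orthonormal]; simp
  have hww : inner ℂ w (Z w) = (diagonalForm b l x : ℂ) := by
    rw [hw, map_sum, sum_inner, diagonalForm]
    push_cast
    refine Finset.sum_congr rfl fun j _ => ?_
    rw [inner_sum, Finset.sum_eq_single j]
    · rw [inner_smul_left, map_smul, inner_smul_right, hl]
      simp only [if_true]
      rw [← Complex.conj_mul']
      ring
    · intro k _ hk
      rw [inner_smul_left, map_smul, inner_smul_right, hl, if_neg (Ne.symm hk)]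
      simp
    · simp
  have hv : inner ℂ (Z ψ - inner ℂ ψ (Z ψ) • ψ) x = inner ℂ ψ (Z w) := by
    have hc : inner ℂ (Z ψ) ψ = inner ℂ ψ (Z ψ) := hZ ψ ψ
    have hr : (starRingEnd ℂ) (inner ℂ ψ (Z ψ)) = inner ℂ ψ (Z ψ) := by
      rw [inner_conj_symm, hc]
    rw [hx, inner_add_right, inner_smul_right, inner_sub_left, inner_sub_left, inner_smul_left,
      inner_smul_left, hψψ, hψw, hr, hc, hZ ψ w]
    ring
  have hexp : inner ℂ x (Z x) = (‖α‖ : ℂ) ^ 2 * inner ℂ ψ (Z ψ) +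
      (starRingEnd ℂ α * inner ℂ ψ (Z w) + starRingEnd ℂ (starRingEnd ℂ α * inner ℂ ψ (Z w))) +
      (diagonalForm b l x : ℂ) := by
    rw [← hww]
    have h1 : starRingEnd ℂ (inner ℂ ψ (Z w)) = inner ℂ w (Z ψ) := by
      rw [inner_conj_symm, hZ]
    conv_lhs => rw [hx]
    rw [map_add, map_smul, inner_add_left, inner_add_right, inner_add_right, inner_smul_left,
      inner_smul_left, inner_smul_right, inner_smul_right, map_mul, h1, Complex.conj_conj,
      ← Complex.conj_mul']
    ring
  have hn : |(starRingEnd ℂ α * inner ℂ ψ (Z w)).re| ≤ ‖α‖ * ‖inner ℂ ψ (Z w)‖ := by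
    refine (Complex.abs_re_le_norm _).trans ?_
    rw [norm_mul, RCLike.norm_conj]
  have hre : (inner ℂ x (Z x)).re = ‖α‖ ^ 2 * (inner ℂ ψ (Z ψ)).re +
      2 * (starRingEnd ℂ α * inner ℂ ψ (Z w)).re + diagonalForm b l x := by
    rw [hexp, Complex.add_re, Complex.add_re, Complex.add_re, Complex.conj_re, Complex.ofReal_re,
      ← Complex.ofReal_pow, Complex.re_ofReal_mul]
    ring
  rw [hre, hv]
  linarith [neg_abs_le (starRingEnd ℂ α * inner ℂ ψ (Z w)).re]

theorem overlap_le_of_re_inner_apply_nonpos (hZ : Z.IsSymmetric) (hb : b none = ψ)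
    (hl : ∀ j k, inner ℂ (b (some j)) (Z (b (some k))) = if j = k then (l j : ℂ) else 0)
    (hψZ : 1 / 3 ≤ (inner ℂ ψ (Z ψ)).re) {x : E} (hx : (inner ℂ x (Z x)).re ≤ 0) :
    ‖inner ℂ ψ x‖ ^ 2 / 6 ≤
      6 * ‖inner ℂ (Z ψ - inner ℂ ψ (Z ψ) • ψ) x‖ ^ 2 + |diagonalForm b l x| := by
  have h := re_inner_apply_lower_bound hZ hb hl x
  have h1 := neg_abs_le (diagonalForm b l x)
  have h2 := mul_le_mul_of_nonneg_left hψZ (sq_nonneg ‖inner ℂ ψ x‖)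
  -- With `a` the overlap and `β` the cross-term factor, `2aβ ≤ a²/6 + 6β²` spends half of the
  -- signal `a²/3`.
  nlinarith [sq_nonneg (‖inner ℂ ψ x‖ - 6 * ‖inner ℂ (Z ψ - inner ℂ ψ (Z ψ) • ψ) x‖)]

theorem abs_le_one_of_diagonal (hZ1 : ∀ x, ‖Z x‖ ≤ ‖x‖)
    (hl : ∀ j k, inner ℂ (b (some j)) (Z (b (some k))) = if j = k then (l j : ℂ) else 0)
    (j : Fin m) : |l j| ≤ 1 := by
  have h := hl j j
  rw [if_pos rfl] at h
  rw [← Real.norm_eq_abs, ← Complex.norm_real, ← h]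
  refine (norm_inner_le_norm _ _).trans ?_
  have := hZ1 (b (some j))
  rw [b.orthonormal.1] at this ⊢
  linarith

/-- The only use of tracelessness: the remaining diagonal entries sum to `-⟨ψ|Z|ψ⟩`. -/
theorem abs_sum_le_one_of_diagonal [FiniteDimensional ℂ E] (hZ1 : ∀ x, ‖Z x‖ ≤ ‖x‖)
    (hZt : LinearMap.trace ℂ E Z = 0) (hb : b none = ψ)
    (hl : ∀ j k, inner ℂ (b (some j)) (Z (b (some k))) = if j = k then (l j : ℂ) else 0) :
    |∑ j, l j| ≤ 1 := by
  rw [LinearMap.trace_eq_sum_inner Z b, Fintype.sum_option, hb] at hZt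
  simp only [hl, if_true] at hZt
  have hψ : ‖ψ‖ = 1 := hb ▸ b.orthonormal.1 none
  have h : ((∑ j, l j : ℝ) : ℂ) = -inner ℂ ψ (Z ψ) := by
    push_cast
    linear_combination hZt
  rw [← Real.norm_eq_abs, ← Complex.norm_real, h, norm_neg]
  refine (norm_inner_le_norm _ _).trans ?_
  have := hZ1 ψ
  rw [hψ] at this ⊢
  linarith

theorem norm_apply_sub_le_one (hZ1 : ∀ x, ‖Z x‖ ≤ ‖x‖) (hψ : ‖ψ‖ = 1) :
    ‖Z ψ - inner ℂ ψ (Z ψ) • ψ‖ ≤ 1 ∧ inner ℂ ψ (Z ψ - inner ℂ ψ (Z ψ) • ψ) = 0 := by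
  have hψψ : inner ℂ ψ ψ = 1 := by rw [inner_self_eq_norm_sq_to_K, hψ]; simp
  have h0 : inner ℂ ψ (Z ψ - inner ℂ ψ (Z ψ) • ψ) = 0 := by
    rw [inner_sub_right, inner_smul_right, hψψ]; ring
  refine ⟨?_, h0⟩
  have h1 := norm_add_sq_eq_norm_sq_add_norm_sq_of_inner_eq_zero (𝕜 := ℂ)
    (inner ℂ ψ (Z ψ) • ψ) (Z ψ - inner ℂ ψ (Z ψ) • ψ) (by rw [inner_smul_left, h0, mul_zero])
  rw [add_sub_cancel] at h1
  have h2 := hZ1 ψ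
  rw [hψ] at h2
  nlinarith [norm_nonneg (Z ψ), norm_nonneg (inner ℂ ψ (Z ψ) • ψ),
    norm_nonneg (Z ψ - inner ℂ ψ (Z ψ) • ψ)]

/-- Both noise terms are controlled by the mass of `x` off `ψ`, at most 1/100, and `7/100 <
(99/100)/6`. -/
theorem re_inner_apply_pos_of_overlap_ge [FiniteDimensional ℂ E] (hZ : Z.IsSymmetric)
    (hZ1 : ∀ x, ‖Z x‖ ≤ ‖x‖) (hb : b none = ψ)
    (hl : ∀ j k, inner ℂ (b (some j)) (Z (b (some k))) = if j = k then (l j : ℂ) else 0)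
    (hψZ : 1 / 3 ≤ (inner ℂ ψ (Z ψ)).re) {x : E} (hx : ‖x‖ = 1)
    (hψx : 99 / 100 ≤ ‖inner ℂ ψ x‖ ^ 2) : 0 < (inner ℂ x (Z x)).re := by
  by_contra! hneg
  have h := overlap_le_of_re_inner_apply_nonpos hZ hb hl hψZ hneg
  have hψ : ‖ψ‖ = 1 := hb ▸ b.orthonormal.1 none
  obtain ⟨hv1, hv0⟩ := norm_apply_sub_le_one hZ1 hψ
  set v := Z ψ - inner ℂ ψ (Z ψ) • ψ
  have hsum := b.sum_sq_norm_inner_right x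
  rw [Fintype.sum_option, hb, hx] at hsum
  have hR : |diagonalForm b l x| ≤ ∑ j, ‖inner ℂ (b (some j)) x‖ ^ 2 := by
    refine (Finset.abs_sum_le_sum_abs _ _).trans (Finset.sum_le_sum fun j _ => ?_)
    rw [abs_mul, abs_of_nonneg (sq_nonneg ‖inner ℂ (b (some j)) x‖)]
    exact mul_le_of_le_one_left (sq_nonneg _) (abs_le_one_of_diagonal hZ1 hl j)
  have hβ : ‖inner ℂ v x‖ ^ 2 ≤ ∑ j, ‖inner ℂ (b (some j)) x‖ ^ 2 := by
    have hψψ : inner ℂ ψ ψ = 1 := by rw [inner_self_eq_norm_sq_to_K, hψ]; simp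
    have hy := norm_add_sq_eq_norm_sq_add_norm_sq_of_inner_eq_zero (𝕜 := ℂ)
      (inner ℂ ψ x • ψ) (x - inner ℂ ψ x • ψ) (by
        rw [inner_smul_left, inner_sub_right, inner_smul_right, hψψ]; ring)
    rw [add_sub_cancel, hx, norm_smul, hψ] at hy
    have hvy : inner ℂ v x = inner ℂ v (x - inner ℂ ψ x • ψ) := by
      rw [inner_sub_right, inner_smul_right, inner_eq_zero_symm.1 hv0]; ring
    have hle : ‖inner ℂ v x‖ ≤ ‖x - inner ℂ ψ x • ψ‖ := by
      rw [hvy]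
      exact (norm_inner_le_norm _ _).trans (mul_le_of_le_one_left (norm_nonneg _) hv1)
    nlinarith [norm_nonneg (inner ℂ v x)]
  linarith

end QuadraticForm

/-! ### Orthonormal pairs and triples containing `ψ`. -/

section OrthonormalTuples

variable {E : Type} [NormedAddCommGroup E] [InnerProductSpace ℂ E]

theorem orthonormal_pair_iff {ψ u : E} :
    Orthonormal ℂ ![ψ, u] ↔ ‖ψ‖ = 1 ∧ ‖u‖ = 1 ∧ inner ℂ ψ u = 0 := by
  rw [orthonormal_vecCons_iff, orthonormal_vecCons_iff]
  simp only [Matrix.cons_val_fin_one, IsEmpty.forall_iff, true_and, forall_const]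
  constructor
  · rintro ⟨h1, h2, h3, -⟩; exact ⟨h1, h3, h2⟩
  · rintro ⟨h1, h2, h3⟩
    exact ⟨h1, h3, h2, by simp [Orthonormal, Pairwise]⟩

theorem OrthonormalBasis.orthonormal_none_some {m : ℕ}
    (b : OrthonormalBasis (Option (Fin m)) ℂ E) (j : Fin m) :
    Orthonormal ℂ ![b none, b (some j)] :=
  orthonormal_pair_iff.2 ⟨b.orthonormal.1 _, b.orthonormal.1 _, b.orthonormal.2 (by simp)⟩

theorem OrthonormalBasis.orthonormal_none_some_some {m : ℕ}
    (b : OrthonormalBasis (Option (Fin m)) ℂ E) {j k : Fin m} (h : j ≠ k) :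
    Orthonormal ℂ ![b none, b (some j), b (some k)] := by
  have hinj : Function.Injective ![none, some j, some k] := by
    intro a c
    fin_cases a <;> fin_cases c <;> simp [h, h.symm]
  have := b.orthonormal.comp _ hinj
  convert this using 1
  ext a
  fin_cases a <;> rfl

end OrthonormalTuples

/-! ### Second moments under stabilizer-invariant measures. -/

section Moments

variable {E : Type} [NormedAddCommGroup E] [InnerProductSpace ℂ E]

/-- The squared overlap `|⟨u|x⟩|²` of a vector with a pure state. -/
noncomputable def sqOverlap (u : E) (x : PureState E) : ℝ := ‖inner ℂ u (x : E)‖ ^ 2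

theorem sqOverlap_nonneg (u : E) (x : PureState E) : 0 ≤ sqOverlap u x := sq_nonneg _

theorem continuous_sqOverlap (u : E) : Continuous (sqOverlap u) := by
  unfold sqOverlap
  fun_prop

theorem sqOverlap_map (U : E ≃ₗᵢ[ℂ] E) (u : E) (x : PureState E) :
    sqOverlap (U u) (sphereMap U x) = sqOverlap u x := by
  simp [sqOverlap, sphereMap]

theorem sum_sqOverlap_le {m : ℕ} (b : OrthonormalBasis (Option (Fin m)) ℂ E) (x : PureState E) :
    ∑ j, sqOverlap (b (some j)) x ≤ 1 := by
  have h := b.sum_sq_norm_inner_right (x : E)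
  rw [Fintype.sum_option, norm_eq_of_mem_sphere x] at h
  have : 0 ≤ ‖inner ℂ (b none) (x : E)‖ ^ 2 := sq_nonneg _
  simp only [sqOverlap]
  linarith

/-- With `P`, `Q` the two squared overlaps and `c` the real inner product of the amplitudes, the
left side is `(P+Q)²/2 + 2c²`, and `c² ≤ PQ`. -/
theorem sqOverlap_add_sub_le (u v : E) (x : PureState E) :
    sqOverlap (((Real.sqrt 2)⁻¹ : ℂ) • (u + v)) x ^ 2 +
        sqOverlap (((Real.sqrt 2)⁻¹ : ℂ) • (u - v)) x ^ 2 ≤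
      (sqOverlap u x ^ 2 + sqOverlap v x ^ 2) / 2 + 3 * (sqOverlap u x * sqOverlap v x) := by
  have hs : ∀ w : E, sqOverlap (((Real.sqrt 2)⁻¹ : ℂ) • w) x = sqOverlap w x / 2 := by
    intro w
    unfold sqOverlap
    rw [inner_smul_left, norm_mul, mul_pow, RCLike.norm_conj, norm_inv, Complex.norm_real,
      Real.norm_of_nonneg (Real.sqrt_nonneg 2), inv_pow, Real.sq_sqrt (by norm_num)]
    ring
  rw [hs, hs]
  unfold sqOverlap
  rw [inner_add_left, inner_sub_left]
  set p := inner ℂ u (x : E)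
  set q := inner ℂ v (x : E)
  have ha : ‖p + q‖ ^ 2 = ‖p‖ ^ 2 + 2 * (inner ℝ p q) + ‖q‖ ^ 2 := norm_add_sq_real p q
  have hb : ‖p - q‖ ^ 2 = ‖p‖ ^ 2 - 2 * (inner ℝ p q) + ‖q‖ ^ 2 := norm_sub_sq_real p q
  have hc : (inner ℝ p q) ^ 2 ≤ ‖p‖ ^ 2 * ‖q‖ ^ 2 := by
    rw [← mul_pow, ← sq_abs]
    exact pow_le_pow_left₀ (abs_nonneg _) (abs_real_inner_le_norm p q) 2
  rw [ha, hb]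
  nlinarith

variable [FiniteDimensional ℂ E] [MeasurableSpace E] [BorelSpace E]

/-- Invariance of a measure on the unit sphere under the linear isometries that fix `ψ`. -/
def StabilizerInvariant (ψ : E) (ν : Measure (PureState E)) : Prop :=
  ∀ U : E ≃ₗᵢ[ℂ] E, U ψ = ψ → MeasurePreserving (sphereMap U) ν ν

theorem integrable_of_continuous_sphere (ν : Measure (PureState E)) [IsFiniteMeasure ν]
    {f : PureState E → ℝ} (hf : Continuous f) : Integrable f ν := by
  have : ProperSpace E := FiniteDimensional.proper ℂ E
  have : CompactSpace (PureState E) := isCompact_iff_compactSpace.1 (isCompact_sphere 0 1)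
  exact hf.integrable_of_hasCompactSupport (HasCompactSupport.of_compactSpace f)

variable {ψ : E} {ν : Measure (PureState E)}

theorem StabilizerInvariant.integral_comp (hν : StabilizerInvariant ψ ν) {U : E ≃ₗᵢ[ℂ] E}
    (hU : U ψ = ψ) {f : PureState E → ℝ} (hf : Continuous f) :
    ∫ x, f (sphereMap U x) ∂ν = ∫ x, f x ∂ν := by
  have : ProperSpace E := FiniteDimensional.proper ℂ E
  have h := hν U hU
  conv_rhs => rw [← h.map_eq]
  exact (integral_map h.aemeasurable hf.aestronglyMeasurable).symm

theorem StabilizerInvariant.integral_sqOverlap_eq (hν : StabilizerInvariant ψ ν) {u v : E}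
    (hu : Orthonormal ℂ ![ψ, u]) (hv : Orthonormal ℂ ![ψ, v]) :
    ∫ x, sqOverlap u x ∂ν = ∫ x, sqOverlap v x ∂ν := by
  obtain ⟨U, hU⟩ := exists_linearIsometryEquiv_map_orthonormal hu hv
  have h0 : U ψ = ψ := hU 0
  have h1 : U u = v := hU 1
  rw [← hν.integral_comp h0 (continuous_sqOverlap v), ← h1]
  simp only [sqOverlap_map]

theorem StabilizerInvariant.integral_sqOverlap_sq_eq (hν : StabilizerInvariant ψ ν) {u v : E}
    (hu : Orthonormal ℂ ![ψ, u]) (hv : Orthonormal ℂ ![ψ, v]) :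
    ∫ x, sqOverlap u x ^ 2 ∂ν = ∫ x, sqOverlap v x ^ 2 ∂ν := by
  obtain ⟨U, hU⟩ := exists_linearIsometryEquiv_map_orthonormal hu hv
  have h0 : U ψ = ψ := hU 0
  have h1 : U u = v := hU 1
  rw [← hν.integral_comp h0 (f := fun x => sqOverlap v x ^ 2) ((continuous_sqOverlap v).pow 2), ← h1]
  simp only [sqOverlap_map]

theorem StabilizerInvariant.integral_sqOverlap_mul_eq (hν : StabilizerInvariant ψ ν)
    {u v u' v' : E} (h : Orthonormal ℂ ![ψ, u, v]) (h' : Orthonormal ℂ ![ψ, u', v']) :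
    ∫ x, sqOverlap u x * sqOverlap v x ∂ν = ∫ x, sqOverlap u' x * sqOverlap v' x ∂ν := by
  obtain ⟨U, hU⟩ := exists_linearIsometryEquiv_map_orthonormal h h'
  have h0 : U ψ = ψ := hU 0
  have h1 : U u = u' := hU 1
  have h2 : U v = v' := hU 2
  rw [← hν.integral_comp h0 (f := fun x => sqOverlap u' x * sqOverlap v' x)
    ((continuous_sqOverlap u').mul (continuous_sqOverlap v')), ← h1, ← h2]
  simp only [sqOverlap_map]

/-- Rotate the pair by 45°: `(u ± v)/√2` have the same fourth moment `p` as `u` and `v`, so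
integrating `sqOverlap_add_sub_le` gives `2p ≤ p + 3q`, with `q` the mixed moment. -/
theorem StabilizerInvariant.integral_sqOverlap_sq_le [IsFiniteMeasure ν]
    (hν : StabilizerInvariant ψ ν) {u v : E} (h : Orthonormal ℂ ![ψ, u, v]) :
    ∫ x, sqOverlap u x ^ 2 ∂ν ≤ 3 * ∫ x, sqOverlap u x * sqOverlap v x ∂ν := by
  have hψ : ‖ψ‖ = 1 := h.1 0
  have hu : ‖u‖ = 1 := h.1 1
  have hv : ‖v‖ = 1 := h.1 2
  have hψu : inner ℂ ψ u = 0 := h.2 (i := 0) (j := 1) (by decide)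
  have hψv : inner ℂ ψ v = 0 := h.2 (i := 0) (j := 2) (by decide)
  have huv : inner ℂ u v = 0 := h.2 (i := 1) (j := 2) (by decide)
  have hnorm : ∀ w : E, ‖w‖ ^ 2 = 2 → ‖((Real.sqrt 2)⁻¹ : ℂ) • w‖ = 1 := by
    intro w hw
    rw [norm_smul, norm_inv, Complex.norm_real, Real.norm_of_nonneg (Real.sqrt_nonneg 2),
      ← hw, Real.sqrt_sq (norm_nonneg w), inv_mul_cancel₀]
    intro h0; rw [h0] at hw; norm_num at hw
  have hadd : ‖u + v‖ ^ 2 = 2 := by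
    rw [sq, norm_add_sq_eq_norm_sq_add_norm_sq_of_inner_eq_zero (𝕜 := ℂ) u v huv, hu, hv]
    norm_num
  have hsub : ‖u - v‖ ^ 2 = 2 := by
    rw [sub_eq_add_neg, sq, norm_add_sq_eq_norm_sq_add_norm_sq_of_inner_eq_zero (𝕜 := ℂ) u (-v)
      (by rw [inner_neg_right, huv, neg_zero]), norm_neg, hu, hv]
    norm_num
  have pu := orthonormal_pair_iff.2 ⟨hψ, hu, hψu⟩
  have pv := orthonormal_pair_iff.2 ⟨hψ, hv, hψv⟩
  have ps := orthonormal_pair_iff.2 ⟨hψ, hnorm _ hadd, by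
    rw [inner_smul_right, inner_add_right, hψu, hψv]; simp⟩
  have pd := orthonormal_pair_iff.2 ⟨hψ, hnorm _ hsub, by
    rw [inner_smul_right, inner_sub_right, hψu, hψv]; simp⟩
  have hi : ∀ w : E, Integrable (fun x => sqOverlap w x ^ 2) ν := fun w =>
    integrable_of_continuous_sphere ν ((continuous_sqOverlap w).pow 2)
  have hi2 : Integrable (fun x => sqOverlap u x * sqOverlap v x) ν :=
    integrable_of_continuous_sphere ν ((continuous_sqOverlap u).mul (continuous_sqOverlap v))
  have hi3 : Integrable (fun x => (sqOverlap u x ^ 2 + sqOverlap v x ^ 2) / 2) ν :=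
    ((hi u).add (hi v)).div_const 2
  have key := integral_mono ((hi _).add (hi _)) (hi3.add (hi2.const_mul 3))
    (sqOverlap_add_sub_le u v)
  simp only [Pi.add_apply] at key
  rw [integral_add (hi _) (hi _), integral_add hi3 (hi2.const_mul 3), integral_div,
    integral_const_mul, integral_add (hi _) (hi _), hν.integral_sqOverlap_sq_eq ps pu,
    hν.integral_sqOverlap_sq_eq pd pu, hν.integral_sqOverlap_sq_eq pv pu] at key
  linarith

/-- By invariance all unit directions orthogonal to `ψ` have equal mean squared overlap, and `m`
orthonormal ones sum to at most 1. -/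
theorem StabilizerInvariant.mul_integral_sqOverlap_le [IsFiniteMeasure ν]
    (hν : StabilizerInvariant ψ ν) {m : ℕ} (b : OrthonormalBasis (Option (Fin m)) ℂ E)
    (hb : b none = ψ) {v : E} (hv : ‖v‖ ≤ 1) (hψv : inner ℂ ψ v = 0) :
    m * ∫ x, sqOverlap v x ∂ν ≤ ν.real Set.univ := by
  have hi : ∀ w : E, Integrable (sqOverlap w) ν := fun w =>
    integrable_of_continuous_sphere ν (continuous_sqOverlap w)
  have hψ : ‖ψ‖ = 1 := hb ▸ b.orthonormal.1 none
  rcases eq_or_ne v 0 with rfl | hv0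
  · simp [sqOverlap]
  · set u := ((‖v‖⁻¹ : ℝ) : ℂ) • v with hu
    have hvu : ∀ x, sqOverlap v x ≤ sqOverlap u x := by
      intro x
      unfold sqOverlap
      rw [hu, inner_smul_left, norm_mul, mul_pow, RCLike.norm_conj, Complex.norm_real, norm_inv,
        norm_norm]
      exact le_mul_of_one_le_left (sq_nonneg _)
        (one_le_pow₀ ((one_le_inv₀ (norm_pos_iff.2 hv0)).2 hv))
    have hpu : Orthonormal ℂ ![ψ, u] := orthonormal_pair_iff.2 ⟨hψ, by
      rw [hu, norm_smul, Complex.norm_real, norm_inv, norm_norm,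
        inv_mul_cancel₀ (norm_ne_zero_iff.2 hv0)], by rw [hu, inner_smul_right, hψv, mul_zero]⟩
    calc m * ∫ x, sqOverlap v x ∂ν ≤ m * ∫ x, sqOverlap u x ∂ν := by
          exact mul_le_mul_of_nonneg_left (integral_mono (hi v) (hi u) hvu) (Nat.cast_nonneg m)
      _ = ∑ j, ∫ x, sqOverlap (b (some j)) x ∂ν := by
          have : ∀ j, ∫ x, sqOverlap (b (some j)) x ∂ν = ∫ x, sqOverlap u x ∂ν := fun j =>
            hν.integral_sqOverlap_eq (hb ▸ b.orthonormal_none_some j) hpu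
          simp [this]
      _ = ∫ x, ∑ j, sqOverlap (b (some j)) x ∂ν := (integral_finsetSum _ fun j _ => hi _).symm
      _ ≤ ∫ _, 1 ∂ν := integral_mono (integrable_finsetSum _ fun j _ => hi _)
          (integrable_const _) (sum_sqOverlap_le b)
      _ = ν.real Set.univ := by simp

theorem StabilizerInvariant.exists_moments (hν : StabilizerInvariant ψ ν)
    [IsFiniteMeasure ν] {m : ℕ} (hm : 2 ≤ m) (b : OrthonormalBasis (Option (Fin m)) ℂ E)
    (hb : b none = ψ) :
    ∃ p q : ℝ, 0 ≤ p ∧ 0 ≤ q ∧ p ≤ 3 * q ∧ ∀ j k : Fin m,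
      ∫ x, sqOverlap (b (some j)) x * sqOverlap (b (some k)) x ∂ν = if j = k then p else q := by
  subst hb
  let i0 : Fin m := ⟨0, by omega⟩
  let i1 : Fin m := ⟨1, by omega⟩
  have h01 : i0 ≠ i1 := by simp [i0, i1]
  refine ⟨∫ x, sqOverlap (b (some i0)) x ^ 2 ∂ν,
    ∫ x, sqOverlap (b (some i0)) x * sqOverlap (b (some i1)) x ∂ν,
    integral_nonneg fun x => sq_nonneg _,
    integral_nonneg fun x => mul_nonneg (sqOverlap_nonneg _ _) (sqOverlap_nonneg _ _),
    hν.integral_sqOverlap_sq_le (b.orthonormal_none_some_some h01), fun j k => ?_⟩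
  split_ifs with h
  · subst h
    simp only [← sq]
    exact hν.integral_sqOverlap_sq_eq (b.orthonormal_none_some _) (b.orthonormal_none_some _)
  · exact hν.integral_sqOverlap_mul_eq (b.orthonormal_none_some_some h)
      (b.orthonormal_none_some_some h01)

/-- Only two moments occur, `p` on the diagonal and `q` off it, so the integral is `(p-q) ∑ l² + q
(∑ l)²`. The sum of the `l j` being at most 1 in modulus keeps the second term at `q` instead of `q
m²`. -/
theorem StabilizerInvariant.integral_diagonalForm_sq_le (hν : StabilizerInvariant ψ ν)
    [IsFiniteMeasure ν] {m : ℕ} (hm : 2 ≤ m) (b : OrthonormalBasis (Option (Fin m)) ℂ E)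
    (hb : b none = ψ) {l : Fin m → ℝ} (hl : ∀ j, |l j| ≤ 1) (hs : |∑ j, l j| ≤ 1) :
    (m - 1) * ∫ x : PureState E, diagonalForm b l (x : E) ^ 2 ∂ν ≤ 3 * ν.real Set.univ := by
  obtain ⟨p, q, hp, hq, hpq, hpair⟩ := hν.exists_moments hm b hb
  have hi : ∀ j k : Fin m,
      Integrable (fun x => sqOverlap (b (some j)) x * sqOverlap (b (some k)) x) ν := fun j k =>
    integrable_of_continuous_sphere ν ((continuous_sqOverlap _).mul (continuous_sqOverlap _))
  have hexp : ∀ a : Fin m → ℝ, ∫ x, (∑ j, a j * sqOverlap (b (some j)) x) ^ 2 ∂ν =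
      (p - q) * ∑ j, a j ^ 2 + q * (∑ j, a j) ^ 2 := by
    intro a
    have h1 : ∀ x, (∑ j, a j * sqOverlap (b (some j)) x) ^ 2 =
        ∑ j, ∑ k, (a j * a k) * (sqOverlap (b (some j)) x * sqOverlap (b (some k)) x) := by
      intro x
      rw [sq, Finset.sum_mul_sum]
      exact Finset.sum_congr rfl fun j _ => Finset.sum_congr rfl fun k _ => by ring
    simp only [h1]
    rw [integral_finsetSum _ fun j _ => integrable_finsetSum _ fun k _ => (hi j k).const_mul _]
    have h2 : ∀ j, ∫ x, ∑ k, (a j * a k) *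
        (sqOverlap (b (some j)) x * sqOverlap (b (some k)) x) ∂ν =
        (p - q) * a j ^ 2 + q * (a j * ∑ k, a k) := by
      intro j
      rw [integral_finsetSum _ fun k _ => (hi j k).const_mul _]
      simp only [integral_const_mul, hpair]
      have h3 : ∀ k, a j * a k * (if j = k then p else q) =
          (if j = k then (p - q) * (a j * a k) else 0) + q * (a j * a k) := by
        intro k; split_ifs <;> ring
      simp only [h3, Finset.sum_add_distrib, Finset.sum_ite_eq, Finset.mem_univ, if_true,
        ← Finset.mul_sum]
      ring
    simp only [h2, Finset.sum_add_distrib, ← Finset.mul_sum, ← Finset.sum_mul]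
    ring
  -- Unit coefficients calibrate `q`: the total squared overlap is at most 1, so `p m + q m (m-1)`
  -- is at most the mass of `ν`.
  have hone := hexp fun _ => 1
  have hle : ∫ x, (∑ j, (1 : ℝ) * sqOverlap (b (some j)) x) ^ 2 ∂ν ≤ ν.real Set.univ := by
    calc _ ≤ ∫ _, (1 : ℝ) ∂ν := by
          refine integral_mono (integrable_of_continuous_sphere ν ?_) (integrable_const _) ?_
          · exact (continuous_finsetSum _ fun j _ =>
              continuous_const.mul (continuous_sqOverlap _)).pow 2
          · intro x
            simp only [one_mul]
            exact pow_le_one₀ (Finset.sum_nonneg fun j _ => sqOverlap_nonneg _ _)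
              (sum_sqOverlap_le b x)
      _ = ν.real Set.univ := by simp
  rw [hone] at hle
  simp only [one_pow, Finset.sum_const, Finset.card_univ, Fintype.card_fin, nsmul_eq_mul,
    mul_one] at hle
  have hsq : ∑ j, l j ^ 2 ≤ m := by
    calc ∑ j, l j ^ 2 ≤ ∑ _j : Fin m, (1 : ℝ) :=
          Finset.sum_le_sum fun j _ => (sq_le_one_iff_abs_le_one _).2 (hl j)
      _ = m := by simp
  have hsq0 : 0 ≤ ∑ j, l j ^ 2 := Finset.sum_nonneg fun j _ => sq_nonneg _
  have hs2 : (∑ j, l j) ^ 2 ≤ 1 := (sq_le_one_iff_abs_le_one _).2 hs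
  have hmain : ∫ x : PureState E, diagonalForm b l (x : E) ^ 2 ∂ν ≤ q * (2 * m + 1) := by
    have h0 : ∫ x : PureState E, diagonalForm b l (x : E) ^ 2 ∂ν =
        (p - q) * ∑ j, l j ^ 2 + q * (∑ j, l j) ^ 2 := hexp l
    rw [h0]
    have h4 : (p - q) * ∑ j, l j ^ 2 ≤ 2 * q * ∑ j, l j ^ 2 := by
      gcongr; linarith
    have h5 : 2 * q * ∑ j, l j ^ 2 ≤ 2 * q * m := by gcongr
    have h6 : q * (∑ j, l j) ^ 2 ≤ q * 1 := by gcongr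
    linarith
  have hm' : (2 : ℝ) ≤ m := by exact_mod_cast hm
  have h7 : q * (m * (m - 1)) ≤ ν.real Set.univ := by
    nlinarith [mul_nonneg hp (by linarith : (0 : ℝ) ≤ m)]
  calc (m - 1) * ∫ x : PureState E, diagonalForm b l (x : E) ^ 2 ∂ν
      ≤ (m - 1) * (q * (2 * m + 1)) := by gcongr; linarith
    _ ≤ 3 * (q * (m * (m - 1))) := by
        nlinarith [mul_nonneg hq (by nlinarith : (0 : ℝ) ≤ (m - 1) * (m - 1))]
    _ ≤ _ := by linarith

end Moments

/-! ### Wrong sign is unlikely at a given overlap level. -/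

section Concentration

variable {E : Type} [NormedAddCommGroup E] [InnerProductSpace ℂ E] [FiniteDimensional ℂ E]
  [MeasurableSpace E] [BorelSpace E]

theorem stabilizerInvariant_haarState_restrict [Nontrivial E] {ψ : E} {S : Set (PureState E)}
    (hS : MeasurableSet S) (hsat : OverlapSaturated ψ S) :
    StabilizerInvariant ψ ((haarState E).restrict S) := by
  intro U hU
  have hmp : MeasurePreserving (sphereMap U) (haarState E) (haarState E) := by
    refine ⟨measurable_sphereMap U, ?_⟩
    ext s hs
    rw [Measure.map_apply (measurable_sphereMap U) hs, haarState_preimage_sphereMap U hs]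
  have hpre : sphereMap U ⁻¹' S = S := by
    have hov : ∀ x : PureState E,
        ‖inner ℂ ((sphereMap U x : PureState E) : E) ψ‖ = ‖inner ℂ (x : E) ψ‖ := by
      intro x
      conv_lhs => rw [← hU]
      change ‖inner ℂ (U (x : E)) (U ψ)‖ = _
      rw [LinearIsometryEquiv.inner_map_map]
    ext x
    exact ⟨hsat _ _ (hov x), hsat _ _ (hov x).symm⟩
  have := hmp.restrict_preimage hS
  rwa [hpre] at this

theorem haarState_real_inter_nonpos_le [Nontrivial E] {Z : E →ₗ[ℂ] E} (hZ : Z.IsSymmetric)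
    (hZ1 : ∀ x, ‖Z x‖ ≤ ‖x‖) (hZt : LinearMap.trace ℂ E Z = 0) {ψ : E} (hψ : ‖ψ‖ = 1)
    (hψZ : 1 / 3 ≤ (inner ℂ ψ (Z ψ)).re) {m : ℕ} (hm : Module.finrank ℂ E = m + 1) (hm2 : 2 ≤ m)
    {t : ℝ} (ht : 0 < t) {S : Set (PureState E)} (hS : MeasurableSet S)
    (hsat : OverlapSaturated ψ S) (hSt : ∀ x ∈ S, t ≤ ‖inner ℂ (x : E) ψ‖ ^ 2) :
    (haarState E).real (S ∩ {x : PureState E | (inner ℂ (x : E) (Z (x : E))).re ≤ 0}) ≤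
      (72 / (t * m) + 432 / (t ^ 2 * (m - 1))) * (haarState E).real S := by
  have := haarState_isProb E
  obtain ⟨b, l, hb, hl⟩ := exists_orthonormalBasis_diagonal_compression hZ hψ hm
  obtain ⟨hv1, hv0⟩ := norm_apply_sub_le_one hZ1 hψ
  set v := Z ψ - inner ℂ ψ (Z ψ) • ψ with hv
  set ν := (haarState E).restrict S with hνdef
  have hν : StabilizerInvariant ψ ν := stabilizerInvariant_haarState_restrict hS hsat
  have hνS : ν.real Set.univ = (haarState E).real S := by simp [hνdef]
  have h1 := hν.mul_integral_sqOverlap_le b hb hv1 hv0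
  have h2 := hν.integral_diagonalForm_sq_le hm2 b hb (abs_le_one_of_diagonal hZ1 hl)
    (abs_sum_le_one_of_diagonal hZ1 hZt hb hl)
  rw [hνS] at h1 h2
  have hc1 : Continuous (sqOverlap v) := continuous_sqOverlap v
  have hc2 : Continuous fun x : PureState E => diagonalForm b l (x : E) ^ 2 := by
    unfold diagonalForm
    fun_prop
  have hi1 := integrable_of_continuous_sphere ν hc1
  have hi2 := integrable_of_continuous_sphere ν hc2
  -- A wrong sign forces `t/6 ≤ 6 * sqOverlap v x + |diagonalForm b l x|`, so one summand is at
  -- least `t/12`; the weights make `f` at least 1 in either case, ready for Markov's inequality.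
  let f : PureState E → ℝ := fun x =>
    72 / t * sqOverlap v x + 144 / t ^ 2 * diagonalForm b l (x : E) ^ 2
  have hf0 : 0 ≤ f := fun x => by
    have := sqOverlap_nonneg v x
    simp only [f, Pi.zero_apply]
    positivity
  have hsub : S ∩ {x : PureState E | (inner ℂ (x : E) (Z (x : E))).re ≤ 0} ⊆
      {x | 1 ≤ f x} ∩ S := by
    rintro x ⟨hxS, hx⟩
    refine ⟨?_, hxS⟩
    have h3 := overlap_le_of_re_inner_apply_nonpos hZ hb hl hψZ hx
    have h4 := hSt x hxS
    rw [norm_inner_symm] at h4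
    have h5 : t / 6 ≤ 6 * sqOverlap v x + |diagonalForm b l (x : E)| := by
      unfold sqOverlap
      linarith
    change 1 ≤ 72 / t * sqOverlap v x + 144 / t ^ 2 * diagonalForm b l (x : E) ^ 2
    have h6 := sqOverlap_nonneg v x
    by_cases h7 : t / 12 ≤ 6 * sqOverlap v x
    · have h8 : 1 ≤ 72 / t * sqOverlap v x := by
        rw [div_mul_eq_mul_div, le_div_iff₀ ht]; linarith
      have : 0 ≤ 144 / t ^ 2 * diagonalForm b l (x : E) ^ 2 := by positivity
      linarith
    · have h8 : t / 12 ≤ |diagonalForm b l (x : E)| := by linarith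
      have h9 : (t / 12) ^ 2 ≤ diagonalForm b l (x : E) ^ 2 := by
        rw [← sq_abs (diagonalForm b l (x : E))]
        exact pow_le_pow_left₀ (by positivity) h8 2
      have h10 : 1 ≤ 144 / t ^ 2 * diagonalForm b l (x : E) ^ 2 := by
        rw [div_mul_eq_mul_div, le_div_iff₀ (by positivity)]; linarith
      have : 0 ≤ 72 / t * sqOverlap v x := by positivity
      linarith
  have hmarkov := mul_meas_ge_le_integral_of_nonneg (μ := ν) (Filter.Eventually.of_forall hf0)
    ((hi1.const_mul (72 / t)).add (hi2.const_mul (144 / t ^ 2))) 1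
  rw [one_mul] at hmarkov
  have hm' : (2 : ℝ) ≤ m := by exact_mod_cast hm2
  calc _ ≤ (haarState E).real ({x | 1 ≤ f x} ∩ S) := measureReal_mono hsub
    _ ≤ ν.real {x | 1 ≤ f x} := by
        rw [hνdef, measureReal_restrict_apply' hS]
    _ ≤ ∫ x, f x ∂ν := hmarkov
    _ = 72 / t * ∫ x, sqOverlap v x ∂ν +
        144 / t ^ 2 * ∫ x : PureState E, diagonalForm b l (x : E) ^ 2 ∂ν := by
        rw [integral_add (hi1.const_mul _) (hi2.const_mul _), integral_const_mul,
          integral_const_mul]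
    _ ≤ 72 / t * ((haarState E).real S / m) +
        144 / t ^ 2 * (3 * (haarState E).real S / (m - 1)) := by
        gcongr
        · rw [le_div_iff₀ (by linarith)]; linarith
        · rw [le_div_iff₀ (by linarith)]; linarith
    _ = _ := by
        have : (m : ℝ) ≠ 0 := by linarith
        have : (m : ℝ) - 1 ≠ 0 := by linarith
        field_simp
        ring

end Concentration

/-! ### Choice of constants and the bound on the number of bits. -/

section FailureProbability

/-- The crude `exp(-x) ≤ 1/x` suffices, since the required `1/r` is a constant absorbed into the
number of bits. -/
theorem one_sub_pow_le_of_le_mul {p p₀ r : ℝ} (hp1 : p ≤ 1) (hp : p₀ ≤ p)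
    (hr : 0 < r) {K : ℕ} (hK : r⁻¹ ≤ p₀ * K) : (1 - p) ^ K ≤ r := by
  have hpK : 0 < p₀ * K := (inv_pos.2 hr).trans_le hK
  calc (1 - p) ^ K ≤ Real.exp (-p₀) ^ K :=
        pow_le_pow_left₀ (by linarith) (by linarith [Real.add_one_le_exp (-p₀)]) K
    _ = (Real.exp (p₀ * K))⁻¹ := by rw [← Real.exp_nat_mul, ← Real.exp_neg]; ring_nf
    _ ≤ (p₀ * K)⁻¹ := inv_anti₀ hpK (by linarith [Real.add_one_le_exp (p₀ * K)])
    _ ≤ r := inv_le_of_inv_le₀ hr hK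

theorem exp_neg_two_mul_le_one_sub {y : ℝ} (h0 : 0 ≤ y) (h1 : y ≤ 1 / 2) :
    Real.exp (-(2 * y)) ≤ 1 - y := by
  rw [Real.exp_neg]
  refine inv_le_of_inv_le₀ (by linarith) ?_
  refine le_trans ?_ (Real.add_one_le_exp (2 * y))
  rw [inv_le_iff_one_le_mul₀ (by linarith)]
  nlinarith

theorem exp_le_two_pow {x : ℝ} {c : ℕ} (h : 2 * x ≤ c) : Real.exp x ≤ 2 ^ c := by
  rw [← Real.exp_log (show (0 : ℝ) < 2 by norm_num), ← Real.exp_nat_mul]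
  refine Real.exp_le_exp.2 ?_
  have h2 : (1 : ℝ) / 2 ≤ Real.log 2 := by linarith [Real.log_two_gt_d9]
  have hc : (0 : ℝ) ≤ c := Nat.cast_nonneg c
  nlinarith

theorem inv_le_exp_neg_mul_two_pow {r s a C : ℝ} (hr : 0 < r) (hs : 1 ≤ s) {c : ℕ}
    (hC : 2 * (a + r⁻¹) ≤ C) (hc : C * s ≤ c) : r⁻¹ ≤ Real.exp (-(a * s)) * (2 ^ c : ℕ) := by
  have hri : 0 < r⁻¹ := inv_pos.2 hr
  have h1 : Real.exp ((a + r⁻¹) * s) ≤ 2 ^ c := exp_le_two_pow (by nlinarith)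
  calc r⁻¹ ≤ Real.exp (r⁻¹ * s) := by nlinarith [Real.add_one_le_exp (r⁻¹ * s)]
    _ = Real.exp (-(a * s)) * Real.exp ((a + r⁻¹) * s) := by rw [← Real.exp_add]; ring_nf
    _ ≤ _ := by push_cast; gcongr

variable {E : Type} [NormedAddCommGroup E] [InnerProductSpace ℂ E] [FiniteDimensional ℂ E]
  [MeasurableSpace E] [BorelSpace E]

theorem measurableSet_re_inner_apply_nonpos (Z : E →ₗ[ℂ] E) :
    MeasurableSet {x : PureState E | (inner ℂ (x : E) (Z (x : E))).re ≤ 0} := by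
  have : ProperSpace E := FiniteDimensional.proper ℂ E
  have hc : Continuous Z := Z.continuous_of_finiteDimensional
  have : Continuous fun x : PureState E => (inner ℂ (x : E) (Z (x : E))).re := by fun_prop
  exact measurableSet_le this.measurable measurable_const

theorem pi_haarState_closest_real_le [Nontrivial E] (ψ : PureState E) {B : Set (PureState E)}
    (hB : MeasurableSet B) {t p₀ r : ℝ} (hr : 0 < r)
    (hp : ENNReal.ofReal p₀ ≤ haarState E {x | t ≤ ‖inner ℂ (x : E) (ψ : E)‖ ^ 2})
    {K : ℕ} [NeZero K] (hK : r⁻¹ ≤ p₀ * K)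
    (h : ∀ S : Set (PureState E), MeasurableSet S → OverlapSaturated (ψ : E) S →
      (∀ x ∈ S, t ≤ ‖inner ℂ (x : E) (ψ : E)‖ ^ 2) →
        (haarState E).real (S ∩ B) ≤ r * (haarState E).real S) :
    (Measure.pi fun _ : Fin K => haarState E).real {φ | φ (closest ψ φ) ∈ B} ≤ 2 * r := by
  have := haarState_isProb E
  set p := haarState E {x | t ≤ ‖inner ℂ (x : E) (ψ : E)‖ ^ 2} with hpdef
  have hp1 : p ≤ 1 := prob_le_one
  have hpt : p ≠ ⊤ := (hp1.trans_lt ENNReal.one_lt_top).ne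
  have key := pi_closest_mem_le (K := K) (haarState E) ψ hB (t := t) (δ := ENNReal.ofReal r) ?_
  · have h1 : (1 - p) ^ K ≤ ENNReal.ofReal r := by
      have h2 := one_sub_pow_le_of_le_mul (p := p.toReal) (ENNReal.toReal_le_of_le_ofReal one_pos.le
        (by simpa using hp1)) ((ENNReal.ofReal_le_iff_le_toReal hpt).1 hp) hr hK
      rw [← ENNReal.ofReal_toReal hpt, ← ENNReal.ofReal_one,
        ← ENNReal.ofReal_sub _ ENNReal.toReal_nonneg, ← ENNReal.ofReal_pow]
      · exact ENNReal.ofReal_le_ofReal h2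
      · have := ENNReal.toReal_mono ENNReal.one_ne_top hp1
        simpa using this
    refine ENNReal.toReal_le_of_le_ofReal (by linarith) (key.trans ?_)
    rw [two_mul, ENNReal.ofReal_add hr.le hr.le]
    gcongr
  · intro S hS hsat hSt
    have h3 := ENNReal.ofReal_le_ofReal (h S hS hsat hSt)
    rwa [ENNReal.ofReal_mul hr.le, ofReal_measureReal, ofReal_measureReal] at h3

theorem exists_bits_closest_nonpos_le {ε : ℝ} (hε : 0 < ε) :
    ∃ C : ℝ, 0 < C ∧ ∀ (E : Type) [NormedAddCommGroup E] [InnerProductSpace ℂ E]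
      [FiniteDimensional ℂ E] [MeasurableSpace E] [BorelSpace E] [Nontrivial E] (c : ℕ),
      C * Real.sqrt (Module.finrank ℂ E) ≤ c → ∀ (Z : E →ₗ[ℂ] E), Z.IsSymmetric →
      (∀ x, ‖Z x‖ ≤ ‖x‖) → LinearMap.trace ℂ E Z = 0 → ∀ ψ : PureState E,
      1 / 3 ≤ (inner ℂ (ψ : E) (Z (ψ : E))).re →
      (Measure.pi fun _ : Fin (2 ^ c) => haarState E).real
        {φ | (inner ℂ (φ (closest ψ φ) : E) (Z (φ (closest ψ φ) : E))).re ≤ 0} ≤ ε := by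
  set r := ε / 2 with hr
  have hr0 : 0 < r := by positivity
  -- At overlap threshold `A/s` the concentration bound is at most `144/A + 864/A = 1008/A`.
  set A := 1008 / r + 1 with hA
  have hA1 : 1 ≤ A := by rw [hA]; linarith [div_pos (show (0 : ℝ) < 1008 by norm_num) hr0]
  have hAr : 1008 / A ≤ r := by
    rw [div_le_iff₀ (by linarith), hA, mul_add, mul_div_cancel₀ _ hr0.ne']
    linarith
  -- Both cases below have cap probability at least `exp(-(800A+1)s)`. The large one needs only
  -- `(4A+1)s`; the small one needs `200(m+1) = 200s² ≤ 800As`.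
  refine ⟨2 * ((800 * A + 1) + r⁻¹), by positivity, ?_⟩
  intro E _ _ _ _ _ _ c hc Z hZ hZ1 hZt ψ hψZ
  have hψ : ‖(ψ : E)‖ = 1 := norm_eq_of_mem_sphere ψ
  obtain ⟨m, hm⟩ := Nat.exists_eq_succ_of_ne_zero (Module.finrank_pos (R := ℂ) (M := E)).ne'
  rw [hm] at hc
  set s := Real.sqrt ((m.succ : ℕ) : ℝ) with hs
  have hs2 : s ^ 2 = m + 1 := by rw [hs, Real.sq_sqrt (Nat.cast_nonneg _)]; push_cast; ring
  have hm0 : (0 : ℝ) ≤ m := Nat.cast_nonneg m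
  have hs1 : 1 ≤ s := by
    rw [hs, Real.one_le_sqrt]; push_cast; linarith
  have hK := inv_le_exp_neg_mul_two_pow hr0 hs1 le_rfl hc
  have hB := measurableSet_re_inner_apply_nonpos Z
  have h2r : ε = 2 * r := by rw [hr]; ring
  rw [h2r]
  -- For `s ≥ 4A` the choice `t = h = A/s` keeps `t + h ≤ 1/2`. Otherwise the dimension is bounded
  -- in terms of `ε`, and an overlap of 99/100 is affordable.
  rcases le_or_gt (4 * A) s with hcase | hcase
  · have ht0 : 0 < A / s := by positivity
    have ht4 : A / s ≤ 1 / 4 := by rw [div_le_iff₀ (by linarith)]; linarith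
    have hs16 : 16 ≤ s ^ 2 := by nlinarith
    have hm2 : 2 ≤ m := by
      have : (15 : ℝ) ≤ m := by linarith
      have : 15 ≤ m := by exact_mod_cast this
      omega
    refine pi_haarState_closest_real_le (t := A / s) ψ hB hr0 ?_ hK fun S hS hsat hSt => ?_
    · refine le_trans (ENNReal.ofReal_le_ofReal ?_)
        (haarState_overlap_ge (ψ : E) hψ hm ht0 ht0.le (by linarith))
      have h1 : Real.exp (-s) ≤ A / s := by
        rw [Real.exp_neg, ← one_div, div_le_div_iff₀ (Real.exp_pos s) (by linarith)]
        nlinarith [Real.add_one_le_exp s, Real.exp_pos s]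
      have h2 : Real.exp (-(4 * A * s)) ≤ (1 - A / s - A / s) ^ m := by
        have h3 := exp_neg_two_mul_le_one_sub (y := A / s + A / s) (by linarith) (by linarith)
        calc Real.exp (-(4 * A * s)) ≤ Real.exp (-(2 * (A / s + A / s))) ^ m := by
              rw [← Real.exp_nat_mul]
              refine Real.exp_le_exp.2 ?_
              have h4 : (m : ℝ) * (A / s) ≤ A * s := by
                rw [mul_div_assoc', div_le_iff₀ (by linarith)]
                nlinarith
              nlinarith
          _ ≤ (1 - (A / s + A / s)) ^ m := pow_le_pow_left₀ (Real.exp_pos _).le h3 m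
          _ = _ := by rw [sub_sub]
      calc Real.exp (-((800 * A + 1) * s)) ≤ Real.exp (-s) * Real.exp (-(4 * A * s)) := by
            rw [← Real.exp_add]
            refine Real.exp_le_exp.2 ?_
            nlinarith
        _ ≤ _ := by gcongr
    · refine (haarState_real_inter_nonpos_le hZ hZ1 hZt hψ hψZ hm hm2 ht0 hS hsat hSt).trans ?_
      refine mul_le_mul_of_nonneg_right (le_trans ?_ hAr) measureReal_nonneg
      have hmD : s ^ 2 / 2 ≤ m := by linarith
      have hmD1 : s ^ 2 / 2 ≤ m - 1 := by linarith
      calc 72 / (A / s * m) + 432 / ((A / s) ^ 2 * (m - 1))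
          ≤ 72 / (A / s * (s ^ 2 / 2)) + 432 / ((A / s) ^ 2 * (s ^ 2 / 2)) := by gcongr
        _ = 144 / (A * s) + 864 / (A * A) := by
            have : s ≠ 0 := by linarith
            have : A ≠ 0 := by linarith
            field_simp
            ring
        _ ≤ 144 / A + 864 / A := by
            gcongr <;> nlinarith
        _ = 1008 / A := by ring
  · refine pi_haarState_closest_real_le (t := 99 / 100) ψ hB hr0 ?_ hK
      fun S hS hsat hSt => ?_
    · refine le_trans (ENNReal.ofReal_le_ofReal ?_) (haarState_overlap_ge (ψ : E) hψ hm
        (h := 1 / 200) (by norm_num) (by norm_num) (by norm_num))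
      have h1 : Real.exp (-200) ≤ 1 / 200 := by
        rw [Real.exp_neg, ← one_div]
        exact one_div_le_one_div_of_le (by norm_num) (by linarith [Real.add_one_le_exp (200 : ℝ)])
      calc Real.exp (-((800 * A + 1) * s)) ≤ Real.exp (-200) ^ (m + 1) := by
            rw [← Real.exp_nat_mul]
            refine Real.exp_le_exp.2 ?_
            push_cast
            nlinarith
        _ ≤ (1 / 200) ^ (m + 1) := pow_le_pow_left₀ (Real.exp_pos _).le h1 _
        _ = _ := by rw [pow_succ']; norm_num
    · obtain ⟨b, l, hb, hl⟩ := exists_orthonormalBasis_diagonal_compression hZ hψ hm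
      have hempty : S ∩ {x : PureState E | (inner ℂ (x : E) (Z (x : E))).re ≤ 0} = ∅ := by
        refine Set.eq_empty_of_forall_notMem fun x hx => ?_
        have h1 := hSt x hx.1
        rw [norm_inner_symm] at h1
        exact absurd hx.2 (not_le.2 (re_inner_apply_pos_of_overlap_ge hZ hZ1 hb hl hψZ
          (norm_eq_of_mem_sphere x) h1))
      rw [hempty, measureReal_empty]
      exact mul_nonneg hr0.le measureReal_nonneg

end FailureProbability

/-! ### The reflection `2M - 1`. -/

section Reflection

variable {E : Type} [NormedAddCommGroup E] [InnerProductSpace ℂ E]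

/-- The reflection `2 M - 1` of a projector `M`. -/
def projectorReflection (M : E →L[ℂ] E) : E →ₗ[ℂ] E := (2 : ℂ) • M.toLinearMap - LinearMap.id

theorem isSymmetric_projectorReflection [CompleteSpace E] {M : E →L[ℂ] E} (hM : IsStarProjection M) :
    (projectorReflection M).IsSymmetric := by
  have h : M.toLinearMap.IsSymmetric := hM.isSelfAdjoint.isSymmetric
  intro x y
  have h1 : inner ℂ (M x) y = inner ℂ x (M y) := h x y
  simp [projectorReflection, inner_sub_left, inner_sub_right, inner_smul_left, inner_smul_right, h1]
  exact Or.inl (map_ofNat (starRingEnd ℂ) 2)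

theorem norm_projectorReflection_le [CompleteSpace E] {M : E →L[ℂ] E} (hM : IsStarProjection M) (x : E) :
    ‖projectorReflection M x‖ ≤ ‖x‖ := by
  have h1 : M (M x) = M x := congrArg (fun T => T x) hM.isIdempotentElem.eq
  have h2 : projectorReflection M (projectorReflection M x) = x := by
    simp only [projectorReflection, LinearMap.sub_apply, LinearMap.smul_apply,
      ContinuousLinearMap.coe_coe, LinearMap.id_apply, map_sub, map_smul, h1]
    module
  have h3 := isSymmetric_projectorReflection hM x (projectorReflection M x)
  rw [h2, inner_self_eq_norm_sq_to_K, inner_self_eq_norm_sq_to_K] at h3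
  have h4 : ‖projectorReflection M x‖ ^ 2 = ‖x‖ ^ 2 := by exact_mod_cast h3
  exact (pow_le_pow_iff_left₀ (norm_nonneg _) (norm_nonneg _) two_ne_zero).1 h4.le

theorem re_inner_projectorReflection (M : E →L[ℂ] E) (x : PureState E) :
    (inner ℂ (x : E) (projectorReflection M (x : E))).re = 2 * expect M (x : E) - 1 := by
  have h1 : inner ℂ (x : E) (x : E) = 1 := by
    rw [inner_self_eq_norm_sq_to_K, norm_eq_of_mem_sphere x]; simp
  have h2 : projectorReflection M (x : E) = (2 : ℂ) • M (x : E) - (x : E) := rfl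
  rw [h2, inner_sub_right, inner_smul_right, h1, expect]
  simp

theorem trace_projectorReflection [FiniteDimensional ℂ E] {M : E →L[ℂ] E}
    (hM : 2 * LinearMap.trace ℂ E M.toLinearMap = Module.finrank ℂ E) :
    LinearMap.trace ℂ E (projectorReflection M) = 0 := by
  rw [projectorReflection, map_sub, map_smul, smul_eq_mul, hM, LinearMap.trace_id, sub_self]

end Reflection

/-! ### Correctness of the closest-state protocol at half rank. -/

section Protocol

variable {E : Type} [NormedAddCommGroup E] [InnerProductSpace ℂ E] [FiniteDimensional ℂ E]
  [MeasurableSpace E] [BorelSpace E] [Nontrivial E] [CompleteSpace E]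

theorem closestStateProtocol_output (c : ℕ) (ψ : PureState E) (M : Projector E)
    (φ : Fin (2 ^ c) → PureState E) :
    (closestStateProtocol E c).bob M φ ((closestStateProtocol E c).alice ψ φ) =
      !decide (expect M.1 (φ (closest ψ φ) : E) ≤ 1 / 2) := by
  change (!decide (expect M.1 (φ ((toBits c).symm (toBits c (closest ψ φ)))) ≤ 1 / 2)) = _
  rw [Equiv.symm_apply_apply]

theorem exists_bits_closestStateProtocol {ε : ℝ} (hε : 0 < ε) :
    ∃ C : ℝ, 0 < C ∧ ∀ (E : Type) [NormedAddCommGroup E] [InnerProductSpace ℂ E]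
      [FiniteDimensional ℂ E] [MeasurableSpace E] [BorelSpace E] [Nontrivial E] [CompleteSpace E]
      (c : ℕ), C * Real.sqrt (Module.finrank ℂ E) ≤ c →
      (closestStateProtocol E c).Computes
        (fun ψ M => 2 * LinearMap.trace ℂ E M.1.toLinearMap = Module.finrank ℂ E ∧
          2 / 3 ≤ expect M.1 (ψ : E))
        (fun ψ M => 2 * LinearMap.trace ℂ E M.1.toLinearMap = Module.finrank ℂ E ∧
          expect M.1 (ψ : E) ≤ 1 / 3) ε := by
  obtain ⟨C, hC, hmain⟩ := exists_bits_closest_nonpos_le hε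
  refine ⟨C, hC, ?_⟩
  intro E _ _ _ _ _ _ _ c hc ψ M
  have := haarState_isProb E
  have hsym := isSymmetric_projectorReflection M.2
  have key : ∀ (a : Bool) (B : Set (Fin (2 ^ c) → PureState E)),
      (Measure.pi fun _ : Fin (2 ^ c) => haarState E).real B ≤ ε →
      (∀ φ ∉ B, (closestStateProtocol E c).bob M φ ((closestStateProtocol E c).alice ψ φ) = a) →
      1 - ε ≤ (closestStateProtocol E c).prOutput ψ M a := by
    intro a B hB hsub
    set G := {φ | (closestStateProtocol E c).bob M φ ((closestStateProtocol E c).alice ψ φ) = a}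
    change 1 - ε ≤ (Measure.pi fun _ : Fin (2 ^ c) => haarState E).real G
    have huniv : B ∪ G = Set.univ := Set.eq_univ_of_forall fun φ => by
      by_cases h : φ ∈ B
      · exact Or.inl h
      · exact Or.inr (hsub φ h)
    have h1 := measureReal_union_le (μ := Measure.pi fun _ : Fin (2 ^ c) => haarState E) B G
    rw [huniv, probReal_univ] at h1
    linarith
  refine ⟨fun h => ?_, fun h => ?_⟩
  · refine key true _ (hmain E c hc (projectorReflection M.1) hsym
      (norm_projectorReflection_le M.2) (trace_projectorReflection h.1) ψ ?_) fun φ hφ => ?_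
    · rw [re_inner_projectorReflection]; linarith [h.2]
    · rw [Set.mem_ofPred_eq, re_inner_projectorReflection, not_le] at hφ
      rw [closestStateProtocol_output]
      simp only [Bool.not_eq_true', decide_eq_false_iff_not, not_le]
      linarith
  -- The bad event includes the tie `⟨φ|M|φ⟩ = 1/2` here too, although Bob's answer 0 would then be
  -- correct.
  · refine key false _ (hmain E c hc (-projectorReflection M.1) ?_ ?_ ?_ ψ ?_) fun φ hφ => ?_
    · intro x y
      simpa using hsym x y
    · intro x
      rw [LinearMap.neg_apply, norm_neg]
      exact norm_projectorReflection_le M.2 x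
    · rw [map_neg, trace_projectorReflection h.1, neg_zero]
    · rw [LinearMap.neg_apply, inner_neg_right, Complex.neg_re, re_inner_projectorReflection]
      linarith [h.2]
    · rw [Set.mem_ofPred_eq, LinearMap.neg_apply, inner_neg_right, Complex.neg_re,
        re_inner_projectorReflection, not_le] at hφ
      rw [closestStateProtocol_output]
      simp only [Bool.not_eq_false', decide_eq_true_eq]
      linarith

end Protocol

/-! ### Doubling to reach half rank. -/

section DoublingLemmas

variable {E : Type} [NormedAddCommGroup E] [InnerProductSpace ℂ E]

theorem expect_doubleOp (M : E →L[ℂ] E) (ψ : PureState E) [CompleteSpace E] :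
    expect (doubleOp M) (doubleState ψ : WithLp 2 (E × E)) = expect M (ψ : E) := by
  simp [expect, doubleOp, doubleState, WithLp.prod_inner_apply]

theorem finrank_withLp_prod_self [FiniteDimensional ℂ E] :
    Module.finrank ℂ (WithLp 2 (E × E)) = 2 * Module.finrank ℂ E := by
  rw [(WithLp.linearEquiv 2 ℂ (E × E)).finrank_eq, Module.finrank_prod, two_mul]

theorem trace_doubleOp [FiniteDimensional ℂ E] (M : E →L[ℂ] E) :
    LinearMap.trace ℂ (WithLp 2 (E × E)) (doubleOp M).toLinearMap = Module.finrank ℂ E := by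
  have h : (doubleOp M).toLinearMap = (WithLp.linearEquiv 2 ℂ (E × E)).symm.conj
      (M.toLinearMap.prodMap (LinearMap.id - M.toLinearMap)) := rfl
  rw [h, LinearMap.trace_conj', LinearMap.trace_prodMap', map_sub, LinearMap.trace_id]
  ring

end DoublingLemmas

theorem mainTheorem7 (ε : ℝ) (hε : 0 < ε) :
    ∃ C : ℝ, 0 < C ∧ ∀ n : ℕ, ∃ c : ℕ, (c : ℝ) ≤ C * Real.sqrt ((2 : ℝ) ^ n) ∧
      ((closestStateProtocol (WithLp 2 (Qubits n × Qubits n)) c).comap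
          doubleState doubleProjector).Computes
        (fun (ψ : PureState (Qubits n)) (M : Projector (Qubits n)) =>
          2 / 3 ≤ expect M.1 (ψ : Qubits n))
        (fun (ψ : PureState (Qubits n)) (M : Projector (Qubits n)) =>
          expect M.1 (ψ : Qubits n) ≤ 1 / 3) ε ∧
      (closestStateProtocol (Qubits n) c).Computes
        (fun (ψ : PureState (Qubits n)) (M : Projector (Qubits n)) =>
          2 * LinearMap.trace ℂ (Qubits n) M.1.toLinearMap = 2 ^ n ∧
            2 / 3 ≤ expect M.1 (ψ : Qubits n))
        (fun (ψ : PureState (Qubits n)) (M : Projector (Qubits n)) =>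
          2 * LinearMap.trace ℂ (Qubits n) M.1.toLinearMap = 2 ^ n ∧
            expect M.1 (ψ : Qubits n) ≤ 1 / 3) ε := by
  obtain ⟨C, hC, hmain⟩ := exists_bits_closestStateProtocol hε
  -- The same `c` must serve dimensions `N` and `2N`: `2C` covers `C√2`, and the extra 1 absorbs the
  -- floor because `√N ≥ 1`.
  refine ⟨2 * C + 1, by linarith, fun n => ?_⟩
  have hfin : Module.finrank ℂ (Qubits n) = 2 ^ n := by simp
  have hfin' : Module.finrank ℂ (WithLp 2 (Qubits n × Qubits n)) = 2 * 2 ^ n := by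
    rw [finrank_withLp_prod_self, hfin]
  have hs1 : 1 ≤ Real.sqrt ((2 : ℝ) ^ n) := by
    rw [Real.one_le_sqrt]; exact one_le_pow₀ (by norm_num)
  refine ⟨⌊(2 * C + 1) * Real.sqrt ((2 : ℝ) ^ n)⌋₊, Nat.floor_le (by positivity), ?_, ?_⟩
  · have hc : C * Real.sqrt (Module.finrank ℂ (WithLp 2 (Qubits n × Qubits n))) ≤
        (⌊(2 * C + 1) * Real.sqrt ((2 : ℝ) ^ n)⌋₊ : ℝ) := by
      have h1 := Nat.lt_floor_add_one ((2 * C + 1) * Real.sqrt ((2 : ℝ) ^ n))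
      have h2 : Real.sqrt 2 ≤ 2 := by rw [Real.sqrt_le_left (by norm_num)]; norm_num
      rw [hfin']
      push_cast
      rw [Real.sqrt_mul (by norm_num)]
      have h3 : C * (Real.sqrt 2 * Real.sqrt ((2 : ℝ) ^ n)) ≤
          C * (2 * Real.sqrt ((2 : ℝ) ^ n)) := by gcongr
      linarith
    intro ψ M
    have h := hmain _ _ hc (doubleState ψ) (doubleProjector M)
    have ht : 2 * LinearMap.trace ℂ _ (doubleProjector M).1.toLinearMap =
        (Module.finrank ℂ (WithLp 2 (Qubits n × Qubits n)) : ℂ) := by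
      rw [finrank_withLp_prod_self, Nat.cast_mul, Nat.cast_ofNat]
      exact congrArg (2 * ·) (trace_doubleOp M.1)
    have he : expect (doubleProjector M).1
        (doubleState ψ : WithLp 2 (Qubits n × Qubits n)) = expect M.1 (ψ : Qubits n) :=
      expect_doubleOp M.1 ψ
    exact ⟨fun h1 => h.1 ⟨ht, he.symm ▸ h1⟩, fun h0 => h.2 ⟨ht, he.symm ▸ h0⟩⟩
  · have hc : C * Real.sqrt (Module.finrank ℂ (Qubits n)) ≤
        (⌊(2 * C + 1) * Real.sqrt ((2 : ℝ) ^ n)⌋₊ : ℝ) := by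
      have h1 := Nat.lt_floor_add_one ((2 * C + 1) * Real.sqrt ((2 : ℝ) ^ n))
      rw [hfin]
      push_cast
      nlinarith
    have h := hmain (Qubits n) _ hc
    rw [hfin] at h
    push_cast at h
    exact h
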